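/- Let $\wedge^3\mathbb{C}^6$ be regarded as the space of antisymmetric tensors in $(\mathbb{C}^6)^{\otimes 3}$ with $v_1\wedge v_2\wedge v_3=\frac{1}{\sqrt{6}}\sum_{\sigma\in S_3}\mathrm{sgn}(\sigma)\,v_{\sigma(1)}\otimes v_{\sigma(2)}\otimes v_{\sigma(3)}$, and let $e_{ijk}=e_i\wedge e_j\wedge e_k$ for the standard basis $e_1,\dots,e_6$ of $\mathbb{C}^6$. Let $\Sigma$ be the set of points $p=(a,b,c,d,z)\in\mathbb{R}^4\times\mathbb{C}$ with $a^2+b^2+c^2+d^2+|z|^2=1$; write $z=x+iy$ with $x,y$ real. Let $\Delta\subset\Sigma$ be the set of those points with $a\ge b\ge c\ge 0$, $x\ge 0$ and $$d=\max\bigl\{|\langle\alpha\wedge\beta\wedge\gamma\,|\,\psi_p\rangle| : \alpha,\beta,\gamma\in\mathbb{C}^6,\ \|\alpha\wedge\beta\wedge\gamma\|=1\bigr\},\qquad \psi_p=a\,e_{235}+b\,e_{145}+c\,e_{136}+d\,e_{246}+z\,e_{135}.$$ Let $S_3$ act on $\mathbb{R}^4\times\mathbb{C}$ by permuting the coordinates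 $a,b,c$, and put $\Theta=\bigcup_{\sigma\in S_3}\sigma\cdot\Delta\subset\Sigma$. Let $\Theta^0$ be the interior of $\Theta$ relative to $\Sigma$ and $\partial\Theta=\Theta\setminus\Theta^0$. Put $$\Phi(p)=d^2(d^2-s_1)(d^2-s_1-|z|^2)-2abcd(x^2-y^2)-4s_3,\qquad s_1=a^2+b^2+c^2,\quad s_3=a^2b^2c^2.$$ Call two vectors $\phi,\psi\in\mathbb{C}^2\otimes\mathbb{C}^2\otimes\mathbb{C}^2$ LU-equivalent if $\psi=(U_1\otimes U_2\otimes U_3)\phi$ for some $U_1,U_2,U_3\in\mathrm{U}(2)$ (no permutation of the qubits is allowed). Proposition. (1) Every normalized pure three-qubit state $|\phi\rangle$ is LU-equivalent to a state $$|\psi\rangle=a|100\rangle+b|010\rangle+c|001\rangle+d|111\rangle+z|000\rangle\qquad\text{with } p=(a,b,c,d,z)\in\Theta .$$ (2) If $|\phi\rangle$ has such a representative with $abcx\,\Phi(p)>0$, then it is the only state of this form with parameters in $\Theta$ that is LU-equivalent to $|\phi\rangle$. (3) For $p\in\Theta$, $abcx\,\Phi(p)>0$ if and only if $p\in\Theta^0$,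 and $abcx\,\Phi(p)=0$ if and only if $p\in\partial\Theta$. (4) Every normalized $|\phi\rangle$ is LU-equivalent to exactly one state $|\psi\rangle$ of the above form with $p\in\Theta$ that satisfies the following requirement: if $abcx\,\Phi(p)=0$, then (i) $y\ge 0$ and (ii) $y=0$ if $abc=0$. -/

import Mathlib

open scoped Kronecker Topology

noncomputable section

namespace ThreeQubit

/-! ### Pure three-qubit states and local unitary equivalence -/

/-- The Hilbert space of three qubits; the vector `|ijk⟩` is the standard basis vector
with index `(i, j, k)`. -/
abbrev QubitSpace : Type := EuclideanSpace ℂ (Fin 2 × Fin 2 × Fin 2)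

/-- The computational basis vector `|ijk⟩`. -/
def ket (i j k : Fin 2) : QubitSpace := EuclideanSpace.single (i, j, k) 1

/-- LU-equivalence of three-qubit vectors, without qubit permutations:
`ψ = (U₁ ⊗ U₂ ⊗ U₃) φ` with `U₁, U₂, U₃ ∈ U(2)`. -/
def LUEquiv (φ ψ : QubitSpace) : Prop :=
  ∃ U₁ ∈ Matrix.unitaryGroup (Fin 2) ℂ, ∃ U₂ ∈ Matrix.unitaryGroup (Fin 2) ℂ,
    ∃ U₃ ∈ Matrix.unitaryGroup (Fin 2) ℂ,
      ψ = Matrix.toEuclideanLin (U₁ ⊗ₖ (U₂ ⊗ₖ U₃)) φ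

/-! ### The parameter space `ℝ⁴ × ℂ` -/

/-- A point `p = ((a, b, c), d, z)` of `ℝ⁴ × ℂ`. -/
abbrev Point : Type := (Fin 3 → ℝ) × ℝ × ℂ

namespace Point

/-- The coordinate `a`. -/
def a (p : Point) : ℝ := p.1 0
/-- The coordinate `b`. -/
def b (p : Point) : ℝ := p.1 1
/-- The coordinate `c`. -/
def c (p : Point) : ℝ := p.1 2
/-- The coordinate `d`. -/
def d (p : Point) : ℝ := p.2.1
/-- The coordinate `z`. -/
def z (p : Point) : ℂ := p.2.2
/-- The real part `x` of the coordinate `z`. -/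
def x (p : Point) : ℝ := p.z.re
/-- The imaginary part `y` of the coordinate `z`. -/
def y (p : Point) : ℝ := p.z.im

/-- The action of `S₃` on `ℝ⁴ × ℂ`: it permutes `a, b, c` and fixes `d` and `z`. -/
def perm (σ : Equiv.Perm (Fin 3)) (p : Point) : Point := (p.1 ∘ σ.symm, p.2)

end Point

/-- The three-qubit vector `a|100⟩ + b|010⟩ + c|001⟩ + d|111⟩ + z|000⟩`. -/
def qubitState (p : Point) : QubitSpace :=
  (p.a : ℂ) • ket 1 0 0 + (p.b : ℂ) • ket 0 1 0 + (p.c : ℂ) • ket 0 0 1 +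
    (p.d : ℂ) • ket 1 1 1 + p.z • ket 0 0 0

/-! ### Three fermions with six single-particle states -/

/-- The third tensor power of `ℂ⁶`, in coordinates. -/
abbrev TensorSpace : Type := EuclideanSpace ℂ (Fin 3 → Fin 6)

/-- The decomposable three-vector `v₀ ∧ v₁ ∧ v₂`, as the antisymmetric tensor
`(1/√3!) ∑_σ sgn(σ) v_{σ 0} ⊗ v_{σ 1} ⊗ v_{σ 2}`: the sum over `σ` is, in each coordinate,
a `3 × 3` determinant. These tensors span `⋀³ ℂ⁶` inside the third tensor power. -/
def wedge (v : Fin 3 → EuclideanSpace ℂ (Fin 6)) : TensorSpace :=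
  WithLp.toLp 2 fun i => ((Real.sqrt 6 : ℝ) : ℂ)⁻¹ * (Matrix.of fun r s => v r (i s)).det

/-- The basis three-vector `e_i ∧ e_j ∧ e_k`, with the basis of `ℂ⁶` numbered from `0` to `5`. -/
def basisWedge (i j k : Fin 6) : TensorSpace :=
  wedge ![EuclideanSpace.single i 1, EuclideanSpace.single j 1, EuclideanSpace.single k 1]

/-- The fermionic state `a e₂₃₅ + b e₁₄₅ + c e₁₃₆ + d e₂₄₆ + z e₁₃₅`, where these subscripts
number the basis of `ℂ⁶` from `1` to `6`. -/
def fermionState (p : Point) : TensorSpace :=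
  (p.a : ℂ) • basisWedge 1 2 4 + (p.b : ℂ) • basisWedge 0 3 4 + (p.c : ℂ) • basisWedge 0 2 5 +
    (p.d : ℂ) • basisWedge 1 3 5 + p.z • basisWedge 0 2 4

/-- The overlaps `|⟨α ∧ β ∧ γ | ψ⟩|` of `ψ` with the decomposable three-vectors of unit norm. -/
def overlaps (ψ : TensorSpace) : Set ℝ :=
  {t | ∃ v : Fin 3 → EuclideanSpace ℂ (Fin 6), ‖wedge v‖ = 1 ∧ t = ‖inner ℂ (wedge v) ψ‖}

/-! ### The canonical regions -/

/-- The unit sphere of `ℝ⁴ × ℂ`. -/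
def Sphere : Set Point := {p | p.a ^ 2 + p.b ^ 2 + p.c ^ 2 + p.d ^ 2 + ‖p.z‖ ^ 2 = 1}

/-- The canonical region `Δ` of three-fermion states: `a ≥ b ≥ c ≥ 0`, `x ≥ 0`, and `d` is the
maximal overlap of the corresponding fermionic state with a decomposable unit three-vector. -/
def Delta : Set Point :=
  {p | p ∈ Sphere ∧ p.b ≤ p.a ∧ p.c ≤ p.b ∧ 0 ≤ p.c ∧ 0 ≤ p.x ∧
    IsGreatest (overlaps (fermionState p)) p.d}

/-- The region `Θ`, the union of the images of `Δ` under `S₃`. -/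
def Theta : Set Point := ⋃ σ : Equiv.Perm (Fin 3), Point.perm σ '' Delta

/-- The interior of `Θ` relative to the unit sphere. -/
def ThetaInterior : Set Point := {p | p ∈ Theta ∧ Theta ∈ 𝓝[Sphere] p}

/-- The boundary of `Θ` relative to the unit sphere. -/
def ThetaBoundary : Set Point := Theta \ ThetaInterior

/-- The polynomial `Φ`, with `s₁ = a² + b² + c²` and `s₃ = a²b²c²`. -/
def Phi (p : Point) : ℝ :=
  let s₁ := p.a ^ 2 + p.b ^ 2 + p.c ^ 2
  let s₃ := p.a ^ 2 * p.b ^ 2 * p.c ^ 2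
  p.d ^ 2 * (p.d ^ 2 - s₁) * (p.d ^ 2 - s₁ - ‖p.z‖ ^ 2)
    - 2 * p.a * p.b * p.c * p.d * (p.x ^ 2 - p.y ^ 2) - 4 * s₃

end ThreeQubit

end

open ThreeQubit

/-! The coordinate d is the maximal overlap of the fermionic state with unit decomposable
three-vectors exactly when d ≥ 0 and no product vector of three qubits, suitably normalized,
overlaps `qubitState p` by more than d (`isGreatest_overlaps_iff`). So `Theta` is cut out of the
sphere by a, b, c, d, x ≥ 0 and this qubit condition (`mem_Theta_iff`).

Existence: move a product vector of maximal overlap to |111⟩. Maximality kills the coefficients at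
|011⟩, |101⟩, |110⟩; diagonal unitaries then make a, b, c, d nonnegative and still leave the sign of
z free, which gives x ≥ 0.

Role of Φ: the best third factor is given by Cauchy–Schwarz, and the slack that remains is a
Hermitian form in the second factor. Its determinant is a real ternary quadratic form in data of the
first factor, and the determinant of that form is d²(d² - b²)(d² - c²)Φ (`quadric_det`). For a point
of `Theta` with a, b, c, x > 0 this gives Φ ≥ 0. If Φ > 0, then |111⟩ is the only maximizer up to
scalars, and the conditions are open. If Φ = 0, there is another maximizer, with no zero coordinate;
increasing x then makes Φ negative, so the point lies on the boundary.

Uniqueness: d is an invariant, being the maximal overlap. With the norm and the determinants of the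
three reduced density matrices it determines a, b, c, |z| (`eq_of_invariants`); if abc ≠ 0, the
hyperdeterminant adds x and y². In the interior the unitaries must fix |111⟩ up to phase, hence are
diagonal, and only z ↦ ±z survives, where x > 0 decides. On the boundary the sign of y is really
ambiguous: for Φ = 0 the second maximizer carries the state to its complex conjugate
(`LUEquiv_conj`), for x = 0 the map z ↦ -z flips y, and for abc = 0 the phase of z is free. This is
what the normalization of y removes. -/

namespace ThreeQubit

/-! ### Contractions with product vectors -/

/-- The contraction of a three-qubit vector with the product of three covectors. -/
noncomputable def contract (φ : QubitSpace) (α β γ : Fin 2 → ℂ) : ℂ :=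
  ∑ i, ∑ j, ∑ k, α i * β j * γ k * φ (i, j, k)

/-- The squared norm of a vector of `ℂ²`. -/
noncomputable def nsq (α : Fin 2 → ℂ) : ℝ := ‖α 0‖ ^ 2 + ‖α 1‖ ^ 2

lemma nsq_nonneg (α : Fin 2 → ℂ) : 0 ≤ nsq α := by unfold nsq; positivity

lemma ofReal_nsq (α : Fin 2 → ℂ) : ((nsq α : ℝ) : ℂ) = α ⬝ᵥ star α := by
  simp [nsq, dotProduct, Fin.sum_univ_two, Complex.mul_conj']

lemma nsq_eq_zero {α : Fin 2 → ℂ} (h : nsq α = 0) : α = 0 := by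
  unfold nsq at h
  have h0 : ‖α 0‖ ^ 2 = 0 := by nlinarith [sq_nonneg ‖α 0‖, sq_nonneg ‖α 1‖]
  have h1 : ‖α 1‖ ^ 2 = 0 := by nlinarith [sq_nonneg ‖α 0‖, sq_nonneg ‖α 1‖]
  ext i
  fin_cases i <;> simp_all

lemma nsq_vecMul {U : Matrix (Fin 2) (Fin 2) ℂ} (hU : U ∈ Matrix.unitaryGroup (Fin 2) ℂ)
    (α : Fin 2 → ℂ) : nsq (Matrix.vecMul α U) = nsq α := by
  have h : ((nsq (Matrix.vecMul α U) : ℝ) : ℂ) = (nsq α : ℝ) := by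
    rw [ofReal_nsq, ofReal_nsq, Matrix.star_vecMul, Matrix.dotProduct_mulVec, Matrix.vecMul_vecMul,
      ← Matrix.star_eq_conjTranspose, Matrix.mem_unitaryGroup_iff.1 hU, Matrix.vecMul_one]
  exact_mod_cast h

lemma contract_apply_single (φ : QubitSpace) (i j k : Fin 2) :
    contract φ (Pi.single i 1) (Pi.single j 1) (Pi.single k 1) = φ (i, j, k) := by
  fin_cases i <;> fin_cases j <;> fin_cases k <;> simp [contract]

/-- The vector `(U₁ ⊗ U₂ ⊗ U₃) φ`. -/
noncomputable def localAct (U₁ U₂ U₃ : Matrix (Fin 2) (Fin 2) ℂ) (φ : QubitSpace) : QubitSpace :=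
  Matrix.toEuclideanLin (U₁ ⊗ₖ (U₂ ⊗ₖ U₃)) φ

lemma localAct_apply (U₁ U₂ U₃ : Matrix (Fin 2) (Fin 2) ℂ) (φ : QubitSpace) (i j k : Fin 2) :
    localAct U₁ U₂ U₃ φ (i, j, k) = contract φ (U₁ i) (U₂ j) (U₃ k) := by
  simp [localAct, contract, Matrix.toLpLin_apply, Matrix.mulVec, dotProduct,
    Fintype.sum_prod_type, Matrix.kroneckerMap_apply, mul_assoc]

lemma contract_localAct (U₁ U₂ U₃ : Matrix (Fin 2) (Fin 2) ℂ) (φ : QubitSpace)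
    (α β γ : Fin 2 → ℂ) :
    contract (localAct U₁ U₂ U₃ φ) α β γ =
      contract φ (Matrix.vecMul α U₁) (Matrix.vecMul β U₂) (Matrix.vecMul γ U₃) := by
  rw [contract]
  simp only [localAct_apply]
  simp only [contract, Matrix.vecMul, dotProduct, Fin.sum_univ_two]
  ring

lemma localAct_localAct (U₁ U₂ U₃ V₁ V₂ V₃ : Matrix (Fin 2) (Fin 2) ℂ) (φ : QubitSpace) :
    localAct V₁ V₂ V₃ (localAct U₁ U₂ U₃ φ) = localAct (V₁ * U₁) (V₂ * U₂) (V₃ * U₃) φ := by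
  ext ⟨i, j, k⟩
  rw [localAct_apply, contract_localAct, localAct_apply]
  rfl

lemma localAct_one (φ : QubitSpace) : localAct 1 1 1 φ = φ := by
  simp [localAct, Matrix.toLpLin_one]

lemma LUEquiv_iff {φ ψ : QubitSpace} : LUEquiv φ ψ ↔
    ∃ U₁ ∈ Matrix.unitaryGroup (Fin 2) ℂ, ∃ U₂ ∈ Matrix.unitaryGroup (Fin 2) ℂ,
    ∃ U₃ ∈ Matrix.unitaryGroup (Fin 2) ℂ, ψ = localAct U₁ U₂ U₃ φ := Iff.rfl

lemma LUEquiv.trans {φ ψ χ : QubitSpace} (h : LUEquiv φ ψ) (h' : LUEquiv ψ χ) : LUEquiv φ χ := by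
  obtain ⟨U₁, h₁, U₂, h₂, U₃, h₃, rfl⟩ := LUEquiv_iff.1 h
  obtain ⟨V₁, k₁, V₂, k₂, V₃, k₃, rfl⟩ := LUEquiv_iff.1 h'
  exact LUEquiv_iff.2 ⟨_, mul_mem k₁ h₁, _, mul_mem k₂ h₂, _, mul_mem k₃ h₃,
    localAct_localAct _ _ _ _ _ _ _⟩

lemma LUEquiv.symm {φ ψ : QubitSpace} (h : LUEquiv φ ψ) : LUEquiv ψ φ := by
  obtain ⟨U₁, h₁, U₂, h₂, U₃, h₃, rfl⟩ := LUEquiv_iff.1 h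
  refine LUEquiv_iff.2 ⟨_, Unitary.star_mem h₁, _, Unitary.star_mem h₂, _, Unitary.star_mem h₃, ?_⟩
  rw [localAct_localAct, Matrix.mem_unitaryGroup_iff'.1 h₁, Matrix.mem_unitaryGroup_iff'.1 h₂,
    Matrix.mem_unitaryGroup_iff'.1 h₃, localAct_one]

lemma LUEquiv.norm_eq {φ ψ : QubitSpace} (h : LUEquiv φ ψ) : ‖ψ‖ = ‖φ‖ := by
  obtain ⟨U₁, h₁, U₂, h₂, U₃, h₃, rfl⟩ := h
  have hU : U₁ ⊗ₖ (U₂ ⊗ₖ U₃) ∈ Matrix.unitaryGroup (Fin 2 × Fin 2 × Fin 2) ℂ :=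
    Matrix.kronecker_mem_unitary h₁ (Matrix.kronecker_mem_unitary h₂ h₃)
  have h2 : (‖Matrix.toEuclideanLin (U₁ ⊗ₖ (U₂ ⊗ₖ U₃)) φ‖ ^ 2 : ℂ) = (‖φ‖ ^ 2 : ℂ) := by
    have e := inner_self_eq_norm_sq_to_K (𝕜 := ℂ) (Matrix.toEuclideanLin (U₁ ⊗ₖ (U₂ ⊗ₖ U₃)) φ)
    have e' := inner_self_eq_norm_sq_to_K (𝕜 := ℂ) φ
    simp only [Complex.coe_algebraMap] at e e'
    rw [← e, ← e', EuclideanSpace.inner_eq_star_dotProduct, EuclideanSpace.inner_eq_star_dotProduct,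
      Matrix.toLpLin_apply]
    rw [Matrix.star_mulVec, dotProduct_comm, ← Matrix.dotProduct_mulVec, Matrix.mulVec_mulVec,
      ← Matrix.star_eq_conjTranspose, Matrix.mem_unitaryGroup_iff'.1 hU, Matrix.one_mulVec,
      dotProduct_comm]
  have h3 : ‖Matrix.toEuclideanLin (U₁ ⊗ₖ (U₂ ⊗ₖ U₃)) φ‖ ^ 2 = ‖φ‖ ^ 2 := by exact_mod_cast h2
  exact (pow_left_inj₀ (norm_nonneg _) (norm_nonneg _) two_ne_zero).1 h3

/-- All overlaps of `φ` with product vectors are at most `d`. -/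
def OverlapBound (φ : QubitSpace) (d : ℝ) : Prop :=
  ∀ α β γ : Fin 2 → ℂ, ‖contract φ α β γ‖ ^ 2 ≤ d ^ 2 * (nsq α * nsq β * nsq γ)

lemma OverlapBound.of_LUEquiv {φ ψ : QubitSpace} {d : ℝ} (h : OverlapBound φ d)
    (e : LUEquiv φ ψ) : OverlapBound ψ d := by
  obtain ⟨U₁, h₁, U₂, h₂, U₃, h₃, rfl⟩ := LUEquiv_iff.1 e
  intro α β γ
  rw [contract_localAct, ← nsq_vecMul h₁ α, ← nsq_vecMul h₂ β, ← nsq_vecMul h₃ γ]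
  exact h _ _ _

/-! ### Local unitary invariants -/

/-- The cyclic permutation of the three qubits. -/
noncomputable def rot (φ : QubitSpace) : QubitSpace :=
  WithLp.toLp 2 fun m => φ (m.2.2, m.1, m.2.1)

lemma rot_apply (φ : QubitSpace) (i j k : Fin 2) : rot φ (i, j, k) = φ (k, i, j) := rfl

lemma contract_rot (φ : QubitSpace) (α β γ : Fin 2 → ℂ) :
    contract (rot φ) α β γ = contract φ γ α β := by
  simp only [contract, rot_apply, Fin.sum_univ_two]
  ring

lemma LUEquiv.rot {φ ψ : QubitSpace} (h : LUEquiv φ ψ) : LUEquiv (rot φ) (rot ψ) := by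
  obtain ⟨U₁, h₁, U₂, h₂, U₃, h₃, rfl⟩ := LUEquiv_iff.1 h
  refine LUEquiv_iff.2 ⟨_, h₂, _, h₃, _, h₁, ?_⟩
  ext ⟨i, j, k⟩
  rw [rot_apply, localAct_apply, localAct_apply, contract_rot]

lemma OverlapBound.rot {φ : QubitSpace} {d : ℝ} (h : OverlapBound φ d) :
    OverlapBound (rot φ) d := by
  intro α β γ
  rw [contract_rot]
  exact (h γ α β).trans_eq (by ring)

/-- The coefficients of a three-qubit vector as a `2 × 4` matrix, whose rows belong to the first
qubit. -/
def flat (φ : QubitSpace) : Matrix (Fin 2) (Fin 2 × Fin 2) ℂ := Matrix.of fun i m => φ (i, m)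

lemma flat_localAct (U₁ U₂ U₃ : Matrix (Fin 2) (Fin 2) ℂ) (φ : QubitSpace) :
    flat (localAct U₁ U₂ U₃ φ) = U₁ * flat φ * (U₂ ⊗ₖ U₃).transpose := by
  ext i ⟨j, k⟩
  simp only [flat, Matrix.of_apply, localAct_apply, contract, Matrix.mul_apply,
    Fintype.sum_prod_type, Fin.sum_univ_two, Matrix.transpose_apply, Matrix.kroneckerMap_apply]
  ring

/-- The determinant of the reduced density matrix of the first qubit. -/
noncomputable def redDet (φ : QubitSpace) : ℂ := (flat φ * (flat φ).conjTranspose).det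

/-- The factor `U₂ ⊗ U₃` cancels in the reduced density matrix, which is merely conjugated by `U₁`.
-/
lemma LUEquiv.redDet_eq {φ ψ : QubitSpace} (h : LUEquiv φ ψ) : redDet ψ = redDet φ := by
  obtain ⟨U₁, h₁, U₂, h₂, U₃, h₃, rfl⟩ := LUEquiv_iff.1 h
  have hV := Matrix.mem_unitaryGroup_iff'.1 (Matrix.kronecker_mem_unitary h₂ h₃)
  have hV' : (U₂ ⊗ₖ U₃).transpose * (U₂ ⊗ₖ U₃).transpose.conjTranspose = 1 := by
    have := congrArg Matrix.transpose hV
    rw [Matrix.transpose_mul, Matrix.transpose_one] at this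
    exact this
  have hU : U₁.det * U₁.conjTranspose.det = 1 := by
    rw [← Matrix.det_mul, ← Matrix.star_eq_conjTranspose, Matrix.mem_unitaryGroup_iff.1 h₁,
      Matrix.det_one]
  rw [redDet, flat_localAct, Matrix.conjTranspose_mul, Matrix.conjTranspose_mul,
    show U₁ * flat φ * (U₂ ⊗ₖ U₃).transpose * ((U₂ ⊗ₖ U₃).transpose.conjTranspose *
      ((flat φ).conjTranspose * U₁.conjTranspose)) = U₁ * (flat φ * ((U₂ ⊗ₖ U₃).transpose *
      (U₂ ⊗ₖ U₃).transpose.conjTranspose) * (flat φ).conjTranspose) * U₁.conjTranspose by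
      simp only [Matrix.mul_assoc], hV', Matrix.mul_one, Matrix.det_mul, Matrix.det_mul, redDet,
    mul_right_comm, hU, one_mul]

/-- Cayley's hyperdeterminant. -/
def hyperdet (T : Fin 2 → Fin 2 → Fin 2 → ℂ) : ℂ :=
  (T 0 0 0 * T 1 1 1 + T 1 0 0 * T 0 1 1 - T 0 0 1 * T 1 1 0 - T 1 0 1 * T 0 1 0) ^ 2 -
    4 * (T 0 0 0 * T 0 1 1 - T 0 0 1 * T 0 1 0) * (T 1 0 0 * T 1 1 1 - T 1 0 1 * T 1 1 0)

lemma hyperdet_cycle (T : Fin 2 → Fin 2 → Fin 2 → ℂ) :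
    hyperdet (fun i j k => T k i j) = hyperdet T := by
  simp only [hyperdet]; ring

lemma hyperdet_mul (U : Matrix (Fin 2) (Fin 2) ℂ) (T : Fin 2 → Fin 2 → Fin 2 → ℂ) :
    hyperdet (fun i j k => ∑ l, U i l * T l j k) = U.det ^ 2 * hyperdet T := by
  simp only [hyperdet, Fin.sum_univ_two, Matrix.det_fin_two]; ring

/-- Cyclic invariance lets the transformation rule for the first index be used for each of the three
indices in turn. -/
lemma hyperdet_localAct (U₁ U₂ U₃ : Matrix (Fin 2) (Fin 2) ℂ) (φ : QubitSpace) :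
    hyperdet (fun i j k => localAct U₁ U₂ U₃ φ (i, j, k)) =
      U₁.det ^ 2 * (U₃.det ^ 2 * (U₂.det ^ 2 * hyperdet fun i j k => φ (i, j, k))) := by
  symm
  rw [← hyperdet_cycle (fun i j k => φ (i, j, k)), ← hyperdet_mul U₂,
    ← hyperdet_cycle, ← hyperdet_mul U₃, ← hyperdet_cycle, ← hyperdet_mul U₁]
  congr 1
  ext i j k
  rw [localAct_apply]
  simp only [contract, Fin.sum_univ_two]
  ring

lemma LUEquiv.norm_hyperdet_eq {φ ψ : QubitSpace} (h : LUEquiv φ ψ) :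
    ‖hyperdet fun i j k => ψ (i, j, k)‖ = ‖hyperdet fun i j k => φ (i, j, k)‖ := by
  obtain ⟨U₁, h₁, U₂, h₂, U₃, h₃, rfl⟩ := LUEquiv_iff.1 h
  have key : ∀ U ∈ Matrix.unitaryGroup (Fin 2) ℂ, ‖Matrix.det U‖ = 1 := fun U hU =>
    CStarRing.norm_of_mem_unitary (Matrix.det_of_mem_unitary hU)
  rw [hyperdet_localAct, norm_mul, norm_mul, norm_mul, norm_pow, norm_pow, norm_pow,
    key _ h₁, key _ h₂, key _ h₃]
  simp

/-! ### The states of canonical form -/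

lemma qubitState_apply (p : Point) (i j k : Fin 2) : qubitState p (i, j, k) =
    ![![![p.z, p.c], ![p.b, 0]], ![![p.a, 0], ![0, p.d]]] i j k := by
  fin_cases i <;> fin_cases j <;> fin_cases k <;> simp [qubitState, ket]

lemma contract_qubitState (p : Point) (α β γ : Fin 2 → ℂ) : contract (qubitState p) α β γ =
    p.a * (α 1 * β 0 * γ 0) + p.b * (α 0 * β 1 * γ 0) + p.c * (α 0 * β 0 * γ 1) +
      p.d * (α 1 * β 1 * γ 1) + p.z * (α 0 * β 0 * γ 0) := by
  simp [contract, qubitState_apply, Fin.sum_univ_two]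
  ring

lemma norm_qubitState_sq (p : Point) :
    ‖qubitState p‖ ^ 2 = p.a ^ 2 + p.b ^ 2 + p.c ^ 2 + p.d ^ 2 + ‖p.z‖ ^ 2 := by
  rw [EuclideanSpace.norm_sq_eq]
  simp [Fintype.sum_prod_type, qubitState_apply]
  ring

lemma mem_sphere_iff (p : Point) : p ∈ Sphere ↔ ‖qubitState p‖ = 1 := by
  have : p ∈ Sphere ↔ ‖qubitState p‖ ^ 2 = 1 := by rw [norm_qubitState_sq]; rfl
  rw [this, pow_eq_one_iff_of_nonneg (norm_nonneg _) two_ne_zero]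

lemma hyperdet_qubitState (p : Point) : (hyperdet fun i j k => qubitState p (i, j, k)) =
    p.d ^ 2 * p.z ^ 2 + 4 * p.a * p.b * p.c * p.d := by
  simp [hyperdet, qubitState_apply]; ring

lemma redDet_qubitState (p : Point) : redDet (qubitState p) =
    (((p.a ^ 2 + p.d ^ 2) * (p.b ^ 2 + p.c ^ 2) + p.d ^ 2 * ‖p.z‖ ^ 2 : ℝ) : ℂ) := by
  simp [redDet, flat, Matrix.det_fin_two, Matrix.mul_apply, Fintype.sum_prod_type,
    qubitState_apply, Matrix.conjTranspose_apply, ← Complex.mul_conj']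
  ring

/-- The point with cyclically permuted coordinates `a, b, c`. -/
def Point.rot (p : Point) : Point := (![p.b, p.c, p.a], p.2)

@[simp] lemma Point.rot_a (p : Point) : p.rot.a = p.b := rfl
@[simp] lemma Point.rot_b (p : Point) : p.rot.b = p.c := rfl
@[simp] lemma Point.rot_c (p : Point) : p.rot.c = p.a := rfl
@[simp] lemma Point.rot_d (p : Point) : p.rot.d = p.d := rfl
@[simp] lemma Point.rot_z (p : Point) : p.rot.z = p.z := rfl
@[simp] lemma Point.rot_x (p : Point) : p.rot.x = p.x := rfl
@[simp] lemma Point.rot_y (p : Point) : p.rot.y = p.y := rfl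

lemma rot_qubitState (p : Point) : rot (qubitState p) = qubitState p.rot := by
  ext ⟨i, j, k⟩
  rw [rot_apply, qubitState_apply, qubitState_apply]
  fin_cases i <;> fin_cases j <;> fin_cases k <;> simp

lemma Point.ext_coords {p q : Point} (ha : p.a = q.a) (hb : p.b = q.b) (hc : p.c = q.c)
    (hd : p.d = q.d) (hz : p.z = q.z) : p = q := by
  refine Prod.ext ?_ (Prod.ext hd hz)
  ext i
  fin_cases i
  exacts [ha, hb, hc]

/-! ### Overlaps of fermionic states with decomposable three-vectors -/

/-- Cauchy–Binet: after expanding both determinants, each σ contributes one copy of the Gram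
determinant, and the six copies cancel the square of 1/√6. -/
lemma inner_wedge_wedge (v w : Fin 3 → EuclideanSpace ℂ (Fin 6)) :
    inner ℂ (wedge v) (wedge w) = (Matrix.of fun r s => inner ℂ (v r) (w s)).det := by
  set G : Matrix (Fin 3) (Fin 3) ℂ := Matrix.of fun r s => inner ℂ (v r) (w s) with hG
  have h6 : ((Real.sqrt 6 : ℝ) : ℂ)⁻¹ * ((Real.sqrt 6 : ℝ) : ℂ)⁻¹ = 6⁻¹ := by
    rw [← mul_inv, ← Complex.ofReal_mul, Real.mul_self_sqrt (by norm_num)]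
    norm_num
  have hsum : ∀ σ τ : Equiv.Perm (Fin 3), ∑ m : Fin 3 → Fin 6,
      (∏ i, star (v (σ i) (m i))) * ∏ i, w (τ i) (m i) = ∏ i, G (σ i) (τ i) := by
    intro σ τ
    simp only [hG, Matrix.of_apply, PiLp.inner_apply, Finset.prod_univ_sum, Fintype.piFinset_univ]
    refine Finset.sum_congr rfl fun m _ => ?_
    rw [← Finset.prod_mul_distrib]
    refine Finset.prod_congr rfl fun i _ => ?_
    simp [mul_comm]
  have hdet : ∀ σ : Equiv.Perm (Fin 3), ∑ τ : Equiv.Perm (Fin 3),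
      ((τ.sign : ℤ) : ℂ) * ∏ i, G (σ i) (τ i) = ((σ.sign : ℤ) : ℂ) * G.det := by
    intro σ
    rw [← Matrix.det_permute, ← Matrix.det_transpose, Matrix.det_apply']
    rfl
  calc inner ℂ (wedge v) (wedge w)
      = 6⁻¹ * ∑ m : Fin 3 → Fin 6, star (Matrix.of fun r s => v r (m s)).det *
          (Matrix.of fun r s => w r (m s)).det := by
        rw [PiLp.inner_apply, Finset.mul_sum]
        refine Finset.sum_congr rfl fun m _ => ?_
        rw [← h6]
        simp [wedge]
        ring
    _ = 6⁻¹ * ∑ σ : Equiv.Perm (Fin 3), ((σ.sign : ℤ) : ℂ) * ∑ τ : Equiv.Perm (Fin 3),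
          ((τ.sign : ℤ) : ℂ) * ∏ i, G (σ i) (τ i) := by
        congr 1
        simp only [Matrix.det_apply', star_sum, Finset.sum_mul_sum]
        simp only [← hsum, Finset.mul_sum]
        rw [Finset.sum_comm]
        refine Finset.sum_congr rfl fun σ _ => ?_
        rw [Finset.sum_comm]
        refine Finset.sum_congr rfl fun τ _ => Finset.sum_congr rfl fun m _ => ?_
        simp only [Matrix.of_apply, star_mul', star_prod]
        rw [show star (((σ.sign : ℤ) : ℂ)) = ((σ.sign : ℤ) : ℂ) by simp]
        ring
    _ = G.det := by
        simp only [hdet, ← mul_assoc, ← Int.cast_mul, Int.units_coe_mul_self]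
        simp [Fintype.card_perm, Nat.factorial]

lemma norm_wedge_of_orthonormal {u : Fin 3 → EuclideanSpace ℂ (Fin 6)} (hu : Orthonormal ℂ u) :
    ‖wedge u‖ = 1 := by
  have h : inner ℂ (wedge u) (wedge u) = 1 := by
    rw [inner_wedge_wedge]
    convert Matrix.det_one (n := Fin 3) (R := ℂ)
    ext r s
    rw [Matrix.of_apply, orthonormal_iff_ite.1 hu, Matrix.one_apply]
  rw [inner_self_eq_norm_sq_to_K] at h
  have h2 : ‖wedge u‖ ^ 2 = 1 := by
    have h3 : ((‖wedge u‖ ^ 2 : ℝ) : ℂ) = 1 := by rw [Complex.ofReal_pow]; exact h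
    exact_mod_cast h3
  exact (pow_eq_one_iff_of_nonneg (norm_nonneg _) two_ne_zero).1 h2

lemma wedge_sum_smul (M : Matrix (Fin 3) (Fin 3) ℂ) (u v : Fin 3 → EuclideanSpace ℂ (Fin 6))
    (h : ∀ r, v r = ∑ s, M r s • u s) : wedge v = M.det • wedge u := by
  ext m
  have : (Matrix.of fun r s => v r (m s)) = M * Matrix.of fun r s => u r (m s) := by
    ext r s
    simp [h, Matrix.mul_apply]
  simp only [wedge, this, Matrix.det_mul, PiLp.smul_apply, smul_eq_mul]
  ring

lemma linearIndependent_of_wedge_ne_zero {v : Fin 3 → EuclideanSpace ℂ (Fin 6)}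
    (h : wedge v ≠ 0) : LinearIndependent ℂ v := by
  by_contra hv
  obtain ⟨g, hg, i, hi⟩ := Fintype.not_linearIndependent_iff.1 hv
  refine h ?_
  ext m
  have : (Matrix.of fun r s => v r (m s)).det = 0 := by
    refine Matrix.exists_vecMul_eq_zero_iff.1 ⟨g, fun h0 => hi (congrFun h0 i), ?_⟩
    ext s
    have := congrArg (fun x : EuclideanSpace ℂ (Fin 6) => x (m s)) hg
    simpa [Matrix.vecMul, dotProduct] using this
  simp [wedge, this]

/-- A decomposable unit three-vector is, up to a phase, the wedge product of an orthonormal triple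
whose last member has no components along the first two basis vectors. -/
lemma exists_orthonormal_wedge {v : Fin 3 → EuclideanSpace ℂ (Fin 6)} (hv : ‖wedge v‖ = 1) :
    ∃ (u : Fin 3 → EuclideanSpace ℂ (Fin 6)) (t : ℂ), Orthonormal ℂ u ∧ u 2 0 = 0 ∧ u 2 1 = 0 ∧
      ‖t‖ = 1 ∧ wedge v = t • wedge u := by
  have hli : LinearIndependent ℂ v := linearIndependent_of_wedge_ne_zero (by
    intro h
    simp [h] at hv)
  set W := Submodule.span ℂ (Set.range v) with hW
  have hfr : Module.finrank ℂ W = Fintype.card (Fin 3) := finrank_span_eq_card hli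
  -- The span is three-dimensional and only two coordinates have to vanish, so the kernel contains a
  -- unit vector; it becomes the last basis member.
  let L : W →ₗ[ℂ] (Fin 2 → ℂ) :=
    { toFun := fun w => ![w.1 0, w.1 1]
      map_add' := fun a b => by ext i; fin_cases i <;> simp
      map_smul' := fun t a => by ext i; fin_cases i <;> simp }
  have hker : LinearMap.ker L ≠ ⊥ := LinearMap.ker_ne_bot_of_finrank_lt (by
    rw [hfr]; simp)
  obtain ⟨w, hw, hw0⟩ := Submodule.exists_mem_ne_zero_of_ne_bot hker
  set g : W := ((‖w‖ : ℂ)⁻¹) • w with hg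
  have hg1 : ‖g‖ = 1 := by
    rw [hg, norm_smul, norm_inv, Complex.norm_real, norm_norm,
      inv_mul_cancel₀ (norm_ne_zero_iff.2 hw0)]
  have hLg : L g = 0 := by rw [hg, map_smul, LinearMap.mem_ker.1 hw, smul_zero]
  have hort : Orthonormal ℂ (({2} : Set (Fin 3)).domRestrict fun _ : Fin 3 => g) := by
    constructor
    · intro _; exact hg1
    · intro i j hij; exact absurd (Subsingleton.elim i j) hij
  obtain ⟨b, hb⟩ := hort.exists_orthonormalBasis_extension_of_card_eq hfr
  have hb2 : b 2 = g := hb 2 rfl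
  let M : Matrix (Fin 3) (Fin 3) ℂ :=
    Matrix.of fun r s => b.repr ⟨v r, Submodule.subset_span ⟨r, rfl⟩⟩ s
  have hbo : Orthonormal ℂ fun i => (b i : EuclideanSpace ℂ (Fin 6)) :=
    b.orthonormal.comp_linearIsometry W.subtypeₗᵢ
  have hwedge : wedge v = M.det • wedge fun i => (b i : EuclideanSpace ℂ (Fin 6)) := by
    refine wedge_sum_smul M _ _ fun r => ?_
    have := congrArg Subtype.val (b.sum_repr ⟨v r, Submodule.subset_span ⟨r, rfl⟩⟩)
    simpa [M] using this.symm
  refine ⟨fun i => b i, M.det, hbo, ?_, ?_, ?_, hwedge⟩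
  · have := congrFun hLg 0
    simpa [L, hb2] using this
  · have := congrFun hLg 1
    simpa [L, hb2] using this
  · rw [hwedge, norm_smul, norm_wedge_of_orthonormal hbo, mul_one] at hv
    exact hv

lemma inner_wedge_fermionState (v : Fin 3 → EuclideanSpace ℂ (Fin 6)) (p : Point) :
    inner ℂ (wedge v) (fermionState p) =
      let D := fun i j k : Fin 6 => (Matrix.of fun r s => star (v r (![i, j, k] s))).det
      p.a * D 1 2 4 + p.b * D 0 3 4 + p.c * D 0 2 5 + p.d * D 1 3 5 + p.z * D 0 2 4 := by
  have h : ∀ i j k : Fin 6, inner ℂ (wedge v) (basisWedge i j k) =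
      (Matrix.of fun r s => star (v r (![i, j, k] s))).det := by
    intro i j k
    rw [basisWedge, inner_wedge_wedge]
    congr 1
    ext r s
    fin_cases s <;> simp [EuclideanSpace.inner_single_right]
  simp only [fermionState, inner_add_right, inner_smul_right, h]

lemma norm_contract_le {φ : QubitSpace} {d : ℝ} (hd : 0 ≤ d) (h : OverlapBound φ d)
    (α β γ : Fin 2 → ℂ) :
    ‖contract φ α β γ‖ ≤ d * (√(nsq α) * √(nsq β) * √(nsq γ)) := by
  refine (pow_le_pow_iff_left₀ (norm_nonneg _) (by positivity) two_ne_zero).1 ?_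
  refine (h α β γ).trans_eq ?_
  rw [mul_pow, mul_pow, mul_pow, Real.sq_sqrt (nsq_nonneg _), Real.sq_sqrt (nsq_nonneg _),
    Real.sq_sqrt (nsq_nonneg _)]

lemma mul_add_mul_le_sqrt {a b c d : ℝ} (h : c ^ 2 + d ^ 2 = 1) :
    a * d + b * c ≤ √(a ^ 2 + b ^ 2) :=
  Real.le_sqrt_of_sq_le (by nlinarith [sq_nonneg (a * c - b * d)])

lemma mul_add_mul_le_one {a b s t : ℝ} (h : a ^ 2 + s ^ 2 = 1) (h' : b ^ 2 + t ^ 2 = 1) :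
    a * t + b * s ≤ 1 := by
  nlinarith [sq_nonneg (a - t), sq_nonneg (b - s)]

/-- Split each vector of ℂ⁶ into three blocks in ℂ². As `u 2` has no first block, the determinants
reduce to four product overlaps, each at most d times the product of block norms. Cauchy–Schwarz
over the blocks of `u 2`, then of `u 0` and `u 1`, bounds their sum by d. -/
lemma norm_inner_fermionState_le_of_orthonormal {p : Point} (hd : 0 ≤ p.d)
    (h : OverlapBound (qubitState p) p.d) {u : Fin 3 → EuclideanSpace ℂ (Fin 6)}
    (hu : Orthonormal ℂ u) (h0 : u 2 0 = 0) (h1 : u 2 1 = 0) :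
    ‖inner ℂ (wedge u) (fermionState p)‖ ≤ p.d := by
  let A : Fin 3 → Fin 2 → ℂ := fun r => ![star (u r 0), star (u r 1)]
  let B : Fin 3 → Fin 2 → ℂ := fun r => ![star (u r 2), star (u r 3)]
  let C : Fin 3 → Fin 2 → ℂ := fun r => ![star (u r 4), star (u r 5)]
  have hn : ∀ r, √(nsq (A r)) ^ 2 + (√(nsq (B r)) ^ 2 + √(nsq (C r)) ^ 2) = 1 := by
    intro r
    rw [Real.sq_sqrt (nsq_nonneg _), Real.sq_sqrt (nsq_nonneg _), Real.sq_sqrt (nsq_nonneg _)]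
    have := hu.1 r
    rw [← pow_eq_one_iff_of_nonneg (norm_nonneg _) two_ne_zero, EuclideanSpace.norm_sq_eq] at this
    simp only [Fin.sum_univ_six] at this
    simp only [nsq, A, B, C]
    simp
    linarith
  have hA2 : √(nsq (A 2)) = 0 := by simp [nsq, A, h0, h1]
  have hform : inner ℂ (wedge u) (fermionState p) =
      (contract (qubitState p) (A 0) (B 1) (C 2) - contract (qubitState p) (A 0) (B 2) (C 1)) -
      (contract (qubitState p) (A 1) (B 0) (C 2) - contract (qubitState p) (A 1) (B 2) (C 0)) := by
    rw [inner_wedge_fermionState]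
    simp [Matrix.det_fin_three, contract_qubitState, A, B, C, h0, h1]
    ring
  have hb := fun i j k => norm_contract_le hd h (A i) (B j) (C k)
  set x : Fin 3 → ℝ := fun r => √(nsq (A r))
  set y : Fin 3 → ℝ := fun r => √(nsq (B r))
  set w : Fin 3 → ℝ := fun r => √(nsq (C r))
  have hx : ∀ r, 0 ≤ x r := fun r => Real.sqrt_nonneg _
  have h2 : y 2 ^ 2 + w 2 ^ 2 = 1 := by
    have := hn 2
    rw [hA2] at this
    linarith
  have e1 := mul_add_mul_le_sqrt (a := y 1) (b := w 1) h2
  have e0 := mul_add_mul_le_sqrt (a := y 0) (b := w 0) h2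
  have e := mul_add_mul_le_one
    (a := x 0) (s := √(y 0 ^ 2 + w 0 ^ 2)) (b := x 1) (t := √(y 1 ^ 2 + w 1 ^ 2))
    (by rw [Real.sq_sqrt (add_nonneg (sq_nonneg (y 0)) (sq_nonneg (w 0)))]; exact hn 0)
    (by rw [Real.sq_sqrt (add_nonneg (sq_nonneg (y 1)) (sq_nonneg (w 1)))]; exact hn 1)
  have m1 := mul_le_mul_of_nonneg_left e1 (hx 0)
  have m0 := mul_le_mul_of_nonneg_left e0 (hx 1)
  rw [hform]
  calc _ ≤ (p.d * (x 0 * y 1 * w 2) + p.d * (x 0 * y 2 * w 1)) +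
        (p.d * (x 1 * y 0 * w 2) + p.d * (x 1 * y 2 * w 0)) :=
      (norm_sub_le _ _).trans (add_le_add ((norm_sub_le _ _).trans (add_le_add (hb _ _ _)
        (hb _ _ _))) ((norm_sub_le _ _).trans (add_le_add (hb _ _ _) (hb _ _ _))))
    _ = p.d * (x 0 * (y 1 * w 2 + w 1 * y 2) + x 1 * (y 0 * w 2 + w 0 * y 2)) := by ring
    _ ≤ p.d * 1 := mul_le_mul_of_nonneg_left (by linarith) hd
    _ = p.d := mul_one _

/-- The triple of vectors of `ℂ⁶` that represents a product vector of three qubits. -/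
noncomputable def productTriple (α β γ : Fin 2 → ℂ) : Fin 3 → EuclideanSpace ℂ (Fin 6) :=
  ![WithLp.toLp 2 ![star (α 0), star (α 1), 0, 0, 0, 0],
    WithLp.toLp 2 ![0, 0, star (β 0), star (β 1), 0, 0],
    WithLp.toLp 2 ![0, 0, 0, 0, star (γ 0), star (γ 1)]]

lemma inner_wedge_productTriple (p : Point) (α β γ : Fin 2 → ℂ) :
    inner ℂ (wedge (productTriple α β γ)) (fermionState p) = contract (qubitState p) α β γ := by
  rw [inner_wedge_fermionState]
  simp [Matrix.det_fin_three, contract_qubitState, productTriple]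

lemma norm_wedge_productTriple {α β γ : Fin 2 → ℂ} (hα : nsq α = 1) (hβ : nsq β = 1)
    (hγ : nsq γ = 1) : ‖wedge (productTriple α β γ)‖ = 1 := by
  have key : ∀ α : Fin 2 → ℂ, nsq α = 1 → α 0 * star (α 0) + α 1 * star (α 1) = 1 := by
    intro α h
    have := ofReal_nsq α
    rw [h] at this
    simpa [dotProduct, Fin.sum_univ_two] using this.symm
  refine norm_wedge_of_orthonormal (orthonormal_iff_ite.2 fun i j => ?_)
  have ha := key α hα
  have hb := key β hβ
  have hc := key γ hγ
  rw [PiLp.inner_apply, Fin.sum_univ_six]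
  simp only [RCLike.inner_apply]
  fin_cases i <;> fin_cases j <;> simp [productTriple] <;>
    first
    | simpa [mul_comm] using ha
    | simpa [mul_comm] using hb
    | simpa [mul_comm] using hc

lemma nsq_smul (t : ℝ) (α : Fin 2 → ℂ) : nsq ((t : ℂ) • α) = t ^ 2 * nsq α := by
  simp [nsq, mul_pow]; ring

lemma contract_smul (φ : QubitSpace) (r s t : ℂ) (α β γ : Fin 2 → ℂ) :
    contract φ (r • α) (s • β) (t • γ) = r * s * t * contract φ α β γ := by
  simp [contract]; ring

/-- A bound for the overlaps with unit product vectors holds for all product vectors. -/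
lemma overlapBound_of_unit {φ : QubitSpace} {d : ℝ}
    (h : ∀ α β γ : Fin 2 → ℂ, nsq α = 1 → nsq β = 1 → nsq γ = 1 → ‖contract φ α β γ‖ ≤ d) :
    OverlapBound φ d := by
  intro α β γ
  have hn := nsq_nonneg
  by_cases h0 : nsq α = 0 ∨ nsq β = 0 ∨ nsq γ = 0
  · have : contract φ α β γ = 0 := by
      rcases h0 with h0 | h0 | h0 <;> simp [contract, nsq_eq_zero h0]
    rw [this]
    have := mul_nonneg (mul_nonneg (hn α) (hn β)) (hn γ)
    simp only [norm_zero, ne_eq, OfNat.ofNat_ne_zero, not_false_eq_true, zero_pow]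
    positivity
  · push Not at h0
    obtain ⟨hα, hβ, hγ⟩ := h0
    have key : ∀ α : Fin 2 → ℂ, nsq α ≠ 0 → nsq (((√(nsq α))⁻¹ : ℝ) • α) = 1 := by
      intro α hα
      have := nsq_smul (√(nsq α))⁻¹ α
      rw [inv_pow, Real.sq_sqrt (hn α), inv_mul_cancel₀ hα] at this
      exact this
    have := h _ _ _ (key α hα) (key β hβ) (key γ hγ)
    have e := contract_smul φ ((√(nsq α))⁻¹ : ℝ) ((√(nsq β))⁻¹ : ℝ) ((√(nsq γ))⁻¹ : ℝ) α β γ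
    have e2 := congrArg (fun x : ℂ => ‖x‖ ^ 2) e
    simp only [norm_mul, mul_pow, Complex.norm_real, Real.norm_eq_abs, sq_abs, inv_pow,
      Real.sq_sqrt (hn _)] at e2
    have h2 := pow_le_pow_left₀ (norm_nonneg _) this 2
    have h3 : (nsq α)⁻¹ * (nsq β)⁻¹ * (nsq γ)⁻¹ * ‖contract φ α β γ‖ ^ 2 ≤ d ^ 2 := by
      rw [← e2]; exact h2
    have pα := (hn α).lt_of_ne' hα
    have pβ := (hn β).lt_of_ne' hβ
    have pγ := (hn γ).lt_of_ne' hγ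
    rw [← mul_inv, ← mul_inv, inv_mul_le_iff₀ (by positivity)] at h3
    linarith

/-- Product vectors embed as decomposable three-vectors with the same overlap, and the triple
belonging to |111⟩ attains d. The bound for arbitrary decomposable vectors comes from a basis with
an empty first block. -/
theorem isGreatest_overlaps_iff (p : Point) :
    IsGreatest (overlaps (fermionState p)) p.d ↔
      0 ≤ p.d ∧ OverlapBound (qubitState p) p.d := by
  constructor
  · rintro ⟨⟨v, -, hv⟩, hub⟩
    refine ⟨hv ▸ norm_nonneg _, overlapBound_of_unit fun α β γ hα hβ hγ => ?_⟩
    rw [← inner_wedge_productTriple]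
    exact hub ⟨_, norm_wedge_productTriple hα hβ hγ, rfl⟩
  · rintro ⟨hd, h⟩
    refine ⟨⟨productTriple (Pi.single 1 1) (Pi.single 1 1) (Pi.single 1 1),
      norm_wedge_productTriple ?_ ?_ ?_, ?_⟩, ?_⟩
    · simp [nsq]
    · simp [nsq]
    · simp [nsq]
    · rw [inner_wedge_productTriple, contract_apply_single, qubitState_apply]
      simp [abs_of_nonneg hd]
    · rintro t ⟨v, hv, rfl⟩
      obtain ⟨u, s, hu, h0, h1, hs, hvu⟩ := exists_orthonormal_wedge hv
      rw [hvu, inner_smul_left, norm_mul, RCLike.norm_conj, hs, one_mul]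
      exact norm_inner_fermionState_le_of_orthonormal hd h hu h0 h1

/-! ### The `S₃`-action, and `Theta` in qubit terms -/

lemma contract_qubitState_eq_sum (p : Point) (α : Fin 3 → Fin 2 → ℂ) :
    contract (qubitState p) (α 0) (α 1) (α 2) =
      ∑ r, (p.1 r : ℂ) * ∏ s, α s (if s = r then 1 else 0) +
        p.d * ∏ s, α s 1 + p.z * ∏ s, α s 0 := by
  rw [contract_qubitState]
  simp [Fin.sum_univ_three, Fin.prod_univ_three, Point.a, Point.b, Point.c]

lemma contract_qubitState_perm (σ : Equiv.Perm (Fin 3)) (p : Point) (α : Fin 3 → Fin 2 → ℂ) :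
    contract (qubitState (p.perm σ)) (α 0) (α 1) (α 2) =
      contract (qubitState p) (α (σ 0)) (α (σ 1)) (α (σ 2)) := by
  rw [contract_qubitState_eq_sum, contract_qubitState_eq_sum p fun s => α (σ s),
    Equiv.prod_comp σ fun s => α s 1, Equiv.prod_comp σ fun s => α s 0, ← Equiv.sum_comp σ]
  congr 2
  refine Finset.sum_congr rfl fun r _ => ?_
  rw [← Equiv.prod_comp σ]
  simp [Point.perm]

lemma OverlapBound.perm {p : Point} {d : ℝ} (h : OverlapBound (qubitState p) d)
    (σ : Equiv.Perm (Fin 3)) : OverlapBound (qubitState (p.perm σ)) d := by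
  intro α β γ
  refine (congrArg (‖·‖ ^ 2) (contract_qubitState_perm σ p ![α, β, γ])).trans_le
    ((h _ _ _).trans_eq ?_)
  have := Equiv.prod_comp σ fun s => nsq (![α, β, γ] s)
  simp only [Fin.prod_univ_three] at this
  rw [this]
  rfl

lemma mem_sphere_perm {p : Point} (h : p ∈ Sphere) (σ : Equiv.Perm (Fin 3)) :
    p.perm σ ∈ Sphere := by
  have e : ∀ p : Point, p ∈ Sphere ↔ ∑ i, p.1 i ^ 2 + p.d ^ 2 + ‖p.z‖ ^ 2 = 1 := by
    intro p
    rw [Fin.sum_univ_three]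
    rfl
  rw [e] at h ⊢
  rw [← h, ← Equiv.sum_comp σ]
  simp [Point.perm, Point.d, Point.z]

/-- The description of `Θ` in terms of three qubits. -/
theorem mem_Theta_iff (p : Point) : p ∈ Theta ↔ p ∈ Sphere ∧ 0 ≤ p.a ∧ 0 ≤ p.b ∧ 0 ≤ p.c ∧
    0 ≤ p.d ∧ 0 ≤ p.x ∧ OverlapBound (qubitState p) p.d := by
  simp only [Theta, Set.mem_iUnion, Set.mem_image, Delta, Set.mem_ofPred_eq, isGreatest_overlaps_iff]
  constructor
  · rintro ⟨σ, q, ⟨hs, hba, hcb, hc, hx, hd, hq⟩, rfl⟩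
    have hq0 : ∀ i, 0 ≤ q.1 i := by
      intro i
      fin_cases i
      exacts [hc.trans (hcb.trans hba), hc.trans hcb, hc]
    exact ⟨mem_sphere_perm hs σ, hq0 _, hq0 _, hq0 _, hd, hx, hq.perm σ⟩
  · rintro ⟨hs, ha, hb, hc, hd, hx, hq⟩
    have hp0 : ∀ i, 0 ≤ p.1 i := by
      intro i
      fin_cases i
      exacts [ha, hb, hc]
    -- All conditions are symmetric in a, b, c, so it suffices to sort these in decreasing order;
    -- hence the sign.
    set σ := Tuple.sort (-p.1) with hσ
    have hm := Tuple.monotone_sort (-p.1)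
    refine ⟨σ, p.perm σ.symm, ⟨mem_sphere_perm hs _, ?_, ?_, hp0 _, hx, hd, hq.perm _⟩, ?_⟩
    · simpa [Point.perm, Point.a, Point.b] using hm (show (0 : Fin 3) ≤ 1 by decide)
    · simpa [Point.perm, Point.b, Point.c] using hm (show (1 : Fin 3) ≤ 2 by decide)
    · refine Prod.ext ?_ rfl
      ext i
      simp [Point.perm]

/-! ### Binary Hermitian and real quadratic forms -/

/-- The Hermitian form with matrix entries `h`, `g` on the diagonal and `-k` off the diagonal. -/
noncomputable def hermForm (h g : ℝ) (k : ℂ) (β : Fin 2 → ℂ) : ℝ :=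
  h * ‖β 1‖ ^ 2 + g * ‖β 0‖ ^ 2 - 2 * (k * β 1 * star (β 0)).re

lemma mul_hermForm (h g : ℝ) (k : ℂ) (β : Fin 2 → ℂ) : h * hermForm h g k β =
    ‖h * β 1 - star k * β 0‖ ^ 2 + (h * g - ‖k‖ ^ 2) * ‖β 0‖ ^ 2 := by
  simp only [hermForm, Complex.sq_norm, Complex.normSq_apply]
  simp
  ring

/-- The test vector (h, k̄) kills the completed square in `mul_hermForm`, leaving the determinant
times h². -/
lemma det_nonneg_of_hermForm_nonneg {h g : ℝ} {k : ℂ} (H : ∀ β, 0 ≤ hermForm h g k β) :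
    0 ≤ h * g - ‖k‖ ^ 2 := by
  have hh : 0 ≤ h := by simpa [hermForm] using H ![0, 1]
  have hg : 0 ≤ g := by simpa [hermForm] using H ![1, 0]
  have h1 := H ![(h : ℂ), star k]
  have h2 := mul_hermForm h g k ![(h : ℂ), star k]
  rcases hh.eq_or_lt with h0 | hpos
  · have hg1 : (0 : ℝ) < g + 1 := by linarith
    obtain ⟨t, ht⟩ : ∃ t : ℝ, t = (g + 1)⁻¹ := ⟨_, rfl⟩
    have e : hermForm h g k ![(t : ℂ) * k * star k, star k] =
        (g * t ^ 2 - 2 * t) * (‖k‖ ^ 2) ^ 2 := by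
      rw [← h0]
      simp only [hermForm, Complex.sq_norm, Complex.normSq_apply]
      simp
      ring
    have h3 := H ![(t : ℂ) * k * star k, star k]
    rw [e] at h3
    have hneg : g * t ^ 2 - 2 * t < 0 := by
      have : g * t ^ 2 - 2 * t = -((g + 2) * t ^ 2) := by
        rw [ht]; field_simp; ring
      rw [this, neg_lt_zero, ht]
      positivity
    have : (‖k‖ ^ 2) ^ 2 ≤ 0 := by
      by_contra hc
      push Not at hc
      nlinarith
    have hk : ‖k‖ ^ 2 = 0 := by nlinarith [sq_nonneg ‖k‖, sq_nonneg (‖k‖ ^ 2)]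
    rw [hk, ← h0]
    simp
  · have h3 : 0 ≤ h * hermForm h g k ![(h : ℂ), star k] := mul_nonneg hh h1
    rw [h2] at h3
    have h4 : (h : ℂ) * ![(h : ℂ), star k] 1 - star k * ![(h : ℂ), star k] 0 = 0 := by
      simp; ring
    rw [h4] at h3
    simp only [norm_zero, Matrix.cons_val_zero, Complex.norm_real, Real.norm_eq_abs, sq_abs] at h3
    have : 0 < h ^ 2 := by positivity
    by_contra hc
    push Not at hc
    nlinarith

lemma hermForm_pos {h g : ℝ} {k : ℂ} (hh : 0 < h) (hd : 0 < h * g - ‖k‖ ^ 2) {β : Fin 2 → ℂ}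
    (hβ : β ≠ 0) : 0 < hermForm h g k β := by
  refine pos_of_mul_pos_right (a := h) ?_ hh.le
  rw [mul_hermForm]
  by_cases h0 : β 0 = 0
  · have h1 : β 1 ≠ 0 := by
      intro h1
      refine hβ ?_
      ext i
      fin_cases i <;> simp [h0, h1]
    have : 0 < ‖(h : ℂ) * β 1‖ := norm_pos_iff.2 (mul_ne_zero (by exact_mod_cast hh.ne') h1)
    simp only [h0, mul_zero, sub_zero, norm_zero]
    positivity
  · have : 0 < ‖β 0‖ := norm_pos_iff.2 h0
    positivity

lemma exists_hermForm_eq_zero {h g : ℝ} {k : ℂ} (hh : 0 < h) (hd : h * g - ‖k‖ ^ 2 = 0) :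
    ∃ β, β ≠ 0 ∧ hermForm h g k β = 0 := by
  refine ⟨![(h : ℂ), star k], fun h0 => hh.ne' ?_, ?_⟩
  · have := congrFun h0 0
    simpa using this
  · have := mul_hermForm h g k ![(h : ℂ), star k]
    rw [hd] at this
    have h4 : (h : ℂ) * ![(h : ℂ), star k] 1 - star k * ![(h : ℂ), star k] 0 = 0 := by
      simp; ring
    rw [h4] at this
    simpa [hh.ne'] using this

lemma quadratic_nonneg {P G Q : ℝ} (h : ∀ v : ℝ, 0 ≤ P * v ^ 2 - 2 * G * v + Q) :
    0 ≤ P ∧ G ^ 2 ≤ P * Q := by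
  have h1 : discrim P (-(2 * G)) Q ≤ 0 := discrim_le_zero fun v => by
    have := h v
    linarith [sq v]
  have h2 : G ^ 2 ≤ P * Q := by
    unfold discrim at h1
    linarith
  refine ⟨?_, h2⟩
  have h0 := h 0
  simp only [ne_eq, OfNat.ofNat_ne_zero, not_false_eq_true, zero_pow, mul_zero, sub_zero,
    zero_add] at h0
  by_contra hP
  push Not at hP
  have h3 : P * Q ≤ 0 := mul_nonpos_of_nonpos_of_nonneg hP.le h0
  have hG : G = 0 := by nlinarith [sq_nonneg G]
  have hQ : Q = 0 := by
    rcases h0.eq_or_lt with h0 | h0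
    · exact h0.symm
    · nlinarith
  have := h 1
  rw [hG, hQ] at this
  linarith

/-! ### The overlap of a canonical state, with the first factor fixed -/

namespace Point

variable (p : Point)

/-- The coefficient of the square of the real part in the overlap quadric. -/
noncomputable def curvRe : ℝ :=
  p.d ^ 2 * (p.d ^ 2 - (p.a ^ 2 + p.b ^ 2 + p.c ^ 2)) - 2 * (p.a * p.b * p.c * p.d)

/-- The coefficient of the square of the imaginary part in the overlap quadric. -/
noncomputable def curvIm : ℝ :=
  p.d ^ 2 * (p.d ^ 2 - (p.a ^ 2 + p.b ^ 2 + p.c ^ 2)) + 2 * (p.a * p.b * p.c * p.d)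

/-- Half the negated linear coefficient of the real part in the overlap quadric. -/
noncomputable def slopeRe : ℝ := (p.d ^ 2 * p.a + p.b * p.c * p.d) * p.x

/-- Half the negated linear coefficient of the imaginary part in the overlap quadric. -/
noncomputable def slopeIm : ℝ := (p.d ^ 2 * p.a - p.b * p.c * p.d) * p.y

/-- The constant coefficient of the overlap quadric. -/
noncomputable def quadConst : ℝ :=
  (p.d ^ 2 - p.b ^ 2) * (p.d ^ 2 - p.c ^ 2) - p.d ^ 2 * (p.x ^ 2 + p.y ^ 2)

/-- The overlap quadric: the homogeneous ternary quadratic form that controls the overlaps of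
`qubitState p` with product vectors whose first factor is fixed. -/
noncomputable def quadric (v w r : ℝ) : ℝ :=
  p.curvRe * v ^ 2 + p.curvIm * w ^ 2 - 2 * (p.slopeRe * v + p.slopeIm * w) * r +
    p.quadConst * r ^ 2

lemma norm_z_sq : ‖p.z‖ ^ 2 = p.x ^ 2 + p.y ^ 2 := by
  rw [Complex.sq_norm, Complex.normSq_apply, Point.x, Point.y]; ring

/-- This is where Φ comes from: the quadric has no v w term, and its determinant is Φ times a factor
that is positive once d² exceeds b² and c². -/
lemma quadric_det : p.quadConst * (p.curvRe * p.curvIm) - p.slopeRe ^ 2 * p.curvIm -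
    p.slopeIm ^ 2 * p.curvRe =
      p.d ^ 2 * (p.d ^ 2 - p.b ^ 2) * (p.d ^ 2 - p.c ^ 2) * Phi p := by
  simp only [quadConst, curvRe, curvIm, slopeRe, slopeIm, Phi, norm_z_sq]
  ring

lemma mul_quadric (v w r : ℝ) : p.curvRe * p.curvIm * p.quadric v w r =
    p.curvIm * (p.curvRe * v - p.slopeRe * r) ^ 2 + p.curvRe * (p.curvIm * w - p.slopeIm * r) ^ 2 +
      p.d ^ 2 * (p.d ^ 2 - p.b ^ 2) * (p.d ^ 2 - p.c ^ 2) * Phi p * r ^ 2 := by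
  rw [← quadric_det, quadric]
  ring

/-- The contraction of `qubitState p` with two vectors, as a vector of the third qubit. -/
noncomputable def contractTwo (α β : Fin 2 → ℂ) : Fin 2 → ℂ :=
  ![p.b * α 0 * β 1 + (p.a * α 1 + p.z * α 0) * β 0, p.d * α 1 * β 1 + p.c * α 0 * β 0]

lemma contract_eq_dotProduct (α β γ : Fin 2 → ℂ) :
    contract (qubitState p) α β γ = p.contractTwo α β ⬝ᵥ γ := by
  simp [contract_qubitState, contractTwo, dotProduct, Fin.sum_univ_two]
  ring

/-- The second diagonal entry of the overlap form. -/
noncomputable def diagEntry (α : Fin 2 → ℂ) : ℝ :=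
  p.d ^ 2 * nsq α - p.c ^ 2 * ‖α 0‖ ^ 2 - ‖p.a * α 1 + p.z * α 0‖ ^ 2

/-- The negated off-diagonal entry of the overlap form. -/
noncomputable def offEntry (α : Fin 2 → ℂ) : ℂ :=
  p.c * p.d * α 1 * star (α 0) + p.b * α 0 * star (p.a * α 1 + p.z * α 0)

lemma slack_eq_hermForm (α β : Fin 2 → ℂ) :
    p.d ^ 2 * (nsq α * nsq β) - nsq (p.contractTwo α β) =
      hermForm ((p.d ^ 2 - p.b ^ 2) * ‖α 0‖ ^ 2) (p.diagEntry α) (p.offEntry α) β := by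
  simp only [hermForm, nsq, diagEntry, offEntry, contractTwo, Complex.sq_norm,
    Complex.normSq_apply]
  simp
  ring

/-- Every term of the determinant depends on α only through α₁ᾱ₀ and |α₀|², so a quartic in α
becomes a real quadratic form in three variables. -/
lemma det_eq_quadric (α : Fin 2 → ℂ) :
    (p.d ^ 2 - p.b ^ 2) * ‖α 0‖ ^ 2 * p.diagEntry α - ‖p.offEntry α‖ ^ 2 =
      p.quadric (α 1 * star (α 0)).re (α 1 * star (α 0)).im (‖α 0‖ ^ 2) := by
  simp only [quadric, curvRe, curvIm, slopeRe, slopeIm, quadConst, nsq, diagEntry, offEntry,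
    Complex.sq_norm, Complex.normSq_apply, Point.x, Point.y]
  simp
  ring

end Point

/-! ### The overlap bound and its maximizers in terms of the Hermitian form -/

lemma nsq_pos {α : Fin 2 → ℂ} (h : α ≠ 0) : 0 < nsq α :=
  (nsq_nonneg α).lt_of_ne' fun h0 => h (nsq_eq_zero h0)

lemma nsq_star (α : Fin 2 → ℂ) : nsq (star α) = nsq α := by simp [nsq]

lemma norm_dotProduct_sq_le (α β : Fin 2 → ℂ) : ‖α ⬝ᵥ β‖ ^ 2 ≤ nsq α * nsq β := by
  have h : ‖α ⬝ᵥ β‖ ≤ ‖α 0‖ * ‖β 0‖ + ‖α 1‖ * ‖β 1‖ := by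
    rw [dotProduct, Fin.sum_univ_two]
    exact (norm_add_le _ _).trans_eq (by rw [norm_mul, norm_mul])
  refine (pow_le_pow_left₀ (norm_nonneg _) h 2).trans ?_
  unfold nsq
  nlinarith [sq_nonneg (‖α 0‖ * ‖β 1‖ - ‖α 1‖ * ‖β 0‖)]

/-- For fixed α and β the best γ is the conjugate of the contraction with both, by Cauchy–Schwarz.
-/
lemma overlapBound_iff (p : Point) : OverlapBound (qubitState p) p.d ↔
    ∀ α β, 0 ≤ hermForm ((p.d ^ 2 - p.b ^ 2) * ‖α 0‖ ^ 2) (p.diagEntry α) (p.offEntry α) β := by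
  simp only [← Point.slack_eq_hermForm, sub_nonneg]
  constructor
  · intro h α β
    have h1 := h α β (star (p.contractTwo α β))
    rw [Point.contract_eq_dotProduct, ← ofReal_nsq, nsq_star, Complex.norm_real, Real.norm_eq_abs,
      sq_abs] at h1
    rcases (nsq_nonneg (p.contractTwo α β)).eq_or_lt with h0 | h0
    · rw [← h0]
      have := nsq_nonneg α
      have := nsq_nonneg β
      positivity
    · refine le_of_mul_le_mul_right (le_of_eq_of_le ?_ h1 |>.trans_eq ?_) h0 <;> ring
  · intro h α β γ
    rw [Point.contract_eq_dotProduct]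
    refine (norm_dotProduct_sq_le _ _).trans ?_
    rw [← mul_assoc (p.d ^ 2)]
    exact mul_le_mul_of_nonneg_right (h α β) (nsq_nonneg γ)

/-- The triple of nonzero vectors `α, β, γ` attains the maximal overlap. -/
def IsMaximizer (φ : QubitSpace) (d : ℝ) (α β γ : Fin 2 → ℂ) : Prop :=
  α ≠ 0 ∧ β ≠ 0 ∧ γ ≠ 0 ∧ ‖contract φ α β γ‖ ^ 2 = d ^ 2 * (nsq α * nsq β * nsq γ)

lemma IsMaximizer.rot {p : Point} {d : ℝ} {α β γ : Fin 2 → ℂ}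
    (h : IsMaximizer (qubitState p) d α β γ) : IsMaximizer (qubitState p.rot) d β γ α := by
  refine ⟨h.2.1, h.2.2.1, h.1, ?_⟩
  rw [← rot_qubitState, contract_rot, h.2.2.2]
  ring

lemma IsMaximizer.hermForm_nonpos {p : Point} {α β γ : Fin 2 → ℂ}
    (h : IsMaximizer (qubitState p) p.d α β γ) :
    hermForm ((p.d ^ 2 - p.b ^ 2) * ‖α 0‖ ^ 2) (p.diagEntry α) (p.offEntry α) β ≤ 0 := by
  rw [← Point.slack_eq_hermForm, sub_nonpos]
  have h1 := h.2.2.2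
  rw [Point.contract_eq_dotProduct] at h1
  refine le_of_mul_le_mul_right ?_ (nsq_pos h.2.2.1)
  exact (le_of_eq (by rw [h1]; ring)).trans (norm_dotProduct_sq_le _ _)

/-! ### Sign conditions and maximizers for points of `Theta` -/

section Theta

variable {p : Point}

lemma Theta_rot (h : p ∈ Theta) : p.rot ∈ Theta := by
  rw [mem_Theta_iff, mem_sphere_iff] at h ⊢
  obtain ⟨hs, ha, hb, hc, hd, hx, hB⟩ := h
  refine ⟨?_, hb, hc, ha, hd, hx, ?_⟩
  · rw [← pow_eq_one_iff_of_nonneg (norm_nonneg _) two_ne_zero, norm_qubitState_sq] at hs ⊢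
    simp only [Point.rot_a, Point.rot_b, Point.rot_c, Point.rot_d, Point.rot_z]
    linarith
  · rw [← rot_qubitState]
    exact hB.rot

lemma Theta_d_pos (h : p ∈ Theta) : 0 < p.d := by
  rw [mem_Theta_iff, mem_sphere_iff] at h
  obtain ⟨hs, ha, hb, hc, hd, hx, hB⟩ := h
  refine hd.lt_of_ne fun h0 => ?_
  have : qubitState p = 0 := by
    ext ⟨i, j, k⟩
    have := hB (Pi.single i 1) (Pi.single j 1) (Pi.single k 1)
    rw [contract_apply_single, ← h0] at this
    simpa using this
  simp [this] at hs

lemma Theta_quadric_nonneg (h : p ∈ Theta) (v w : ℝ) : 0 ≤ p.quadric v w 1 := by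
  rw [mem_Theta_iff] at h
  have := det_nonneg_of_hermForm_nonneg ((overlapBound_iff p).1 h.2.2.2.2.2.2 ![1, ⟨v, w⟩])
  rw [Point.det_eq_quadric] at this
  simpa using this

lemma Theta_curvRe (h : p ∈ Theta) : 0 ≤ p.curvRe ∧ p.slopeRe ^ 2 ≤ p.curvRe * p.quadConst :=
  quadratic_nonneg fun v => by
    have := Theta_quadric_nonneg h v 0
    simp only [Point.quadric] at this
    linarith

lemma Theta_sum_le (h : p ∈ Theta) : p.a ^ 2 + p.b ^ 2 + p.c ^ 2 ≤ p.d ^ 2 := by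
  have hd := Theta_d_pos h
  have h1 := (Theta_curvRe h).1
  rw [mem_Theta_iff] at h
  obtain ⟨hs, ha, hb, hc, -, hx, hB⟩ := h
  have : 0 ≤ p.a * p.b * p.c * p.d := by positivity
  have h2 : 0 ≤ p.d ^ 2 * (p.d ^ 2 - (p.a ^ 2 + p.b ^ 2 + p.c ^ 2)) := by
    unfold Point.curvRe at h1
    linarith
  have := nonneg_of_mul_nonneg_right h2 (by positivity)
  linarith

/-- The four coordinates `a, b, c, x` are positive. -/
def Point.Positive (p : Point) : Prop := 0 < p.a ∧ 0 < p.b ∧ 0 < p.c ∧ 0 < p.x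

lemma Point.Positive.rot (h : p.Positive) : p.rot.Positive := ⟨h.2.1, h.2.2.1, h.1, h.2.2.2⟩

lemma Theta_positive_of_ne (h : p ∈ Theta) (h0 : p.a * p.b * p.c * p.x ≠ 0) : p.Positive := by
  rw [mem_Theta_iff] at h
  obtain ⟨hs, ha, hb, hc, -, hx, hB⟩ := h
  simp only [ne_eq, mul_eq_zero, not_or] at h0
  obtain ⟨⟨⟨h1, h2⟩, h3⟩, h4⟩ := h0
  exact ⟨ha.lt_of_ne' h1, hb.lt_of_ne' h2, hc.lt_of_ne' h3, hx.lt_of_ne' h4⟩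

/-- The linear coefficient `slopeRe` is positive, and its square is at most the product of the two
quantities. -/
lemma Theta_curvRe_pos (h : p ∈ Theta) (hp : p.Positive) : 0 < p.curvRe ∧ 0 < p.quadConst := by
  obtain ⟨h1, h2⟩ := Theta_curvRe h
  have hd := Theta_d_pos h
  obtain ⟨ha, hb, hc, hx⟩ := hp
  have hs : 0 < p.slopeRe := by unfold Point.slopeRe; positivity
  have h3 : 0 < p.curvRe * p.quadConst := lt_of_lt_of_le (by positivity) h2
  have h4 : 0 < p.curvRe := h1.lt_of_ne fun h0 => by
    rw [← h0, zero_mul] at h3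
    exact h3.false
  exact ⟨h4, pos_of_mul_pos_right h3 h1⟩

lemma Point.Positive.curvIm_pos (hp : p.Positive) (hd : 0 < p.d) (h : 0 < p.curvRe) :
    0 < p.curvIm := by
  obtain ⟨ha, hb, hc, hx⟩ := hp
  have : 0 < p.a * p.b * p.c * p.d := by positivity
  unfold Point.curvRe at h
  unfold Point.curvIm
  linarith

lemma Point.Positive.sum_lt (hp : p.Positive) (hd : 0 < p.d) (h : 0 < p.curvRe) :
    p.a ^ 2 + p.b ^ 2 + p.c ^ 2 < p.d ^ 2 := by
  obtain ⟨ha, hb, hc, hx⟩ := hp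
  have : 0 < p.a * p.b * p.c * p.d := by positivity
  have h2 : 0 < p.d ^ 2 * (p.d ^ 2 - (p.a ^ 2 + p.b ^ 2 + p.c ^ 2)) := by
    unfold Point.curvRe at h
    linarith
  have := pos_of_mul_pos_right h2 (by positivity)
  linarith

lemma Theta_Phi_nonneg (h : p ∈ Theta) (hp : p.Positive) : 0 ≤ Phi p := by
  have hd := Theta_d_pos h
  have h1 := (Theta_curvRe_pos h hp).1
  have h2 := hp.curvIm_pos hd h1
  have h3 := hp.sum_lt hd h1
  obtain ⟨ha, hb, hc, hx⟩ := hp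
  -- At this point both squares in `mul_quadric` vanish and only the Φ term is left.
  have hq := Theta_quadric_nonneg h (p.slopeRe / p.curvRe) (p.slopeIm / p.curvIm)
  have e := p.mul_quadric (p.slopeRe / p.curvRe) (p.slopeIm / p.curvIm) 1
  rw [mul_div_cancel₀ _ h1.ne', mul_div_cancel₀ _ h2.ne'] at e
  have h4 : 0 ≤ p.curvRe * p.curvIm * p.quadric (p.slopeRe / p.curvRe) (p.slopeIm / p.curvIm) 1 :=
    by positivity
  rw [e] at h4
  have hb2 : 0 < p.d ^ 2 - p.b ^ 2 := by nlinarith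
  have hc2 : 0 < p.d ^ 2 - p.c ^ 2 := by nlinarith
  refine nonneg_of_mul_nonneg_right (b := Phi p)
    (a := p.d ^ 2 * (p.d ^ 2 - p.b ^ 2) * (p.d ^ 2 - p.c ^ 2)) ?_ (by positivity)
  linarith

lemma quadric_pos (hp : p.Positive) (hd : 0 < p.d) (h : 0 < p.curvRe) (hΦ : 0 < Phi p)
    (v w : ℝ) {r : ℝ} (hr : r ≠ 0) : 0 < p.quadric v w r := by
  have h2 := hp.curvIm_pos hd h
  have h3 := hp.sum_lt hd h
  obtain ⟨ha, hb, hc, hx⟩ := hp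
  refine pos_of_mul_pos_right (a := p.curvRe * p.curvIm) ?_ (by positivity)
  rw [p.mul_quadric]
  have hb2 : 0 < p.d ^ 2 - p.b ^ 2 := by nlinarith
  have hc2 : 0 < p.d ^ 2 - p.c ^ 2 := by nlinarith
  positivity

lemma hermForm_pos_of_Phi_pos (hp : p.Positive) (hd : 0 < p.d) (h : 0 < p.curvRe)
    (hΦ : 0 < Phi p) {α β : Fin 2 → ℂ} (hα : α 0 ≠ 0) (hβ : β ≠ 0) :
    0 < hermForm ((p.d ^ 2 - p.b ^ 2) * ‖α 0‖ ^ 2) (p.diagEntry α) (p.offEntry α) β := by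
  have h3 := hp.sum_lt hd h
  have hn : 0 < ‖α 0‖ := norm_pos_iff.2 hα
  have hb2 : 0 < p.d ^ 2 - p.b ^ 2 := by nlinarith [hp.1, sq_nonneg p.c]
  refine hermForm_pos (by positivity) ?_ hβ
  rw [Point.det_eq_quadric]
  exact quadric_pos hp hd h hΦ _ _ (by positivity)

lemma hermForm_of_zero {α : Fin 2 → ℂ} (hα : α 0 = 0) (β : Fin 2 → ℂ) :
    hermForm ((p.d ^ 2 - p.b ^ 2) * ‖α 0‖ ^ 2) (p.diagEntry α) (p.offEntry α) β =
      (p.d ^ 2 - p.a ^ 2) * ‖α 1‖ ^ 2 * ‖β 0‖ ^ 2 := by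
  simp [hermForm, Point.diagEntry, Point.offEntry, hα, nsq, mul_pow]
  left
  ring

/-- Only strict inequalities are assumed here, not membership in `Theta`; this makes `Theta` a
relative neighbourhood of such points. -/
lemma overlapBound_of_Phi_pos (hp : p.Positive) (hd : 0 < p.d) (h : 0 < p.curvRe)
    (hΦ : 0 < Phi p) : OverlapBound (qubitState p) p.d := by
  rw [overlapBound_iff]
  intro α β
  by_cases hα : α 0 = 0
  · rw [hermForm_of_zero hα]
    have h3 := hp.sum_lt hd h
    have : 0 ≤ p.d ^ 2 - p.a ^ 2 := by nlinarith [sq_nonneg p.b, sq_nonneg p.c]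
    positivity
  · by_cases hβ : β = 0
    · simp [hβ, hermForm]
    · exact (hermForm_pos_of_Phi_pos hp hd h hΦ hα hβ).le

lemma Phi_rot : Phi p.rot = Phi p := by
  simp only [Phi, Point.rot_a, Point.rot_b, Point.rot_c, Point.rot_d, Point.rot_x, Point.rot_y,
    Point.rot_z]
  ring

lemma IsMaximizer.fst_eq_zero (h : p ∈ Theta) (hp : p.Positive) (hΦ : 0 < Phi p)
    {α β γ : Fin 2 → ℂ} (hm : IsMaximizer (qubitState p) p.d α β γ) : α 0 = 0 := by
  by_contra hα
  exact (hermForm_pos_of_Phi_pos hp (Theta_d_pos h) (Theta_curvRe_pos h hp).1 hΦ hα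
    hm.2.1).not_ge hm.hermForm_nonpos

/-- In the interior of `Θ` the maximal overlap is only attained at `|111⟩`. -/
lemma IsMaximizer.eq_zero (h : p ∈ Theta) (hp : p.Positive) (hΦ : 0 < Phi p)
    {α β γ : Fin 2 → ℂ} (hm : IsMaximizer (qubitState p) p.d α β γ) :
    α 0 = 0 ∧ β 0 = 0 ∧ γ 0 = 0 :=
  ⟨hm.fst_eq_zero h hp hΦ, hm.rot.fst_eq_zero (Theta_rot h) hp.rot (by rw [Phi_rot]; exact hΦ),
    hm.rot.rot.fst_eq_zero (Theta_rot (Theta_rot h)) hp.rot.rot (by rw [Phi_rot, Phi_rot]; exact hΦ)⟩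

/-- For α₁ = 0 the quadric reduces to its positive constant coefficient, so the Hermitian form is
definite and no β can reach the bound. -/
lemma IsMaximizer.fst_one_ne_zero (h : p ∈ Theta) (hp : p.Positive) {α β γ : Fin 2 → ℂ}
    (hm : IsMaximizer (qubitState p) p.d α β γ) : α 1 ≠ 0 := by
  intro hα
  have h3 := hp.sum_lt (Theta_d_pos h) (Theta_curvRe_pos h hp).1
  have hb2 : 0 < p.d ^ 2 - p.b ^ 2 := by nlinarith [hp.1, sq_nonneg p.c]
  have h0 : 0 < ‖α 0‖ := norm_pos_iff.2 fun h0 => hm.1 (by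
    ext i; fin_cases i <;> simp [h0, hα])
  refine (hermForm_pos (by positivity) ?_ hm.2.1).not_ge hm.hermForm_nonpos
  rw [Point.det_eq_quadric, hα]
  have := (Theta_curvRe_pos h hp).2
  simp only [Point.quadric, zero_mul, Complex.zero_re, Complex.zero_im]
  simp only [ne_eq, OfNat.ofNat_ne_zero, not_false_eq_true, zero_pow, mul_zero, add_zero, zero_mul,
    sub_zero, zero_add]
  positivity

lemma IsMaximizer.snd_eq_zero (h : p ∈ Theta) (hp : p.Positive) {α β γ : Fin 2 → ℂ}
    (hm : IsMaximizer (qubitState p) p.d α β γ) (hα : α 0 = 0) : β 0 = 0 := by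
  have h1 := hm.hermForm_nonpos
  rw [hermForm_of_zero hα] at h1
  have h3 := hp.sum_lt (Theta_d_pos h) (Theta_curvRe_pos h hp).1
  have ha2 : 0 < p.d ^ 2 - p.a ^ 2 := by nlinarith [hp.2.1, sq_nonneg p.c]
  by_contra hβ
  have h4 : 0 < ‖α 1‖ := norm_pos_iff.2 (hm.fst_one_ne_zero h hp)
  have h5 : 0 < ‖β 0‖ := norm_pos_iff.2 hβ
  have : 0 < (p.d ^ 2 - p.a ^ 2) * ‖α 1‖ ^ 2 * ‖β 0‖ ^ 2 := by positivity
  linarith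

/-- If `Φ` vanishes, the maximal overlap is also attained at a product vector all of whose
coordinates are nonzero. -/
lemma exists_isMaximizer (h : p ∈ Theta) (hp : p.Positive) (hΦ : Phi p = 0) :
    ∃ α β γ, IsMaximizer (qubitState p) p.d α β γ ∧ (∀ i, α i ≠ 0) ∧ (∀ i, β i ≠ 0) ∧
      ∀ i, γ i ≠ 0 := by
  have hd := Theta_d_pos h
  have h1 := (Theta_curvRe_pos h hp).1
  have h2 := hp.curvIm_pos hd h1
  have h3 := hp.sum_lt hd h1
  have hb2 : 0 < p.d ^ 2 - p.b ^ 2 := by nlinarith [hp.1, sq_nonneg p.c]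
  -- The critical point of the quadric is a zero of it because Φ = 0. The Hermitian form is then
  -- degenerate: β is a null vector, and γ is the conjugate of the remaining contraction.
  set α : Fin 2 → ℂ := ![1, ⟨p.slopeRe / p.curvRe, p.slopeIm / p.curvIm⟩] with hα
  have hdet : (p.d ^ 2 - p.b ^ 2) * ‖α 0‖ ^ 2 * p.diagEntry α - ‖p.offEntry α‖ ^ 2 = 0 := by
    rw [Point.det_eq_quadric]
    have e := p.mul_quadric (p.slopeRe / p.curvRe) (p.slopeIm / p.curvIm) 1
    rw [mul_div_cancel₀ _ h1.ne', mul_div_cancel₀ _ h2.ne', hΦ] at e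
    simpa [hα, h1.ne', h2.ne'] using e
  have hα0 : α 0 ≠ 0 := by simp [hα]
  obtain ⟨β, hβ, hβ0⟩ := exists_hermForm_eq_zero (by simp [hα, hb2]) hdet
  rw [← Point.slack_eq_hermForm, sub_eq_zero] at hβ0
  have hα' : α ≠ 0 := fun h0 => hα0 (by rw [h0]; rfl)
  have hγ : p.contractTwo α β ≠ 0 := by
    intro h0
    have := nsq_pos hα'
    have := nsq_pos hβ
    have : 0 < p.d ^ 2 * (nsq α * nsq β) := by positivity
    rw [hβ0, h0] at this
    simp [nsq] at this
  have hm : IsMaximizer (qubitState p) p.d α β (star (p.contractTwo α β)) := by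
    refine ⟨hα', hβ, star_ne_zero.2 hγ, ?_⟩
    rw [Point.contract_eq_dotProduct, ← ofReal_nsq, nsq_star, Complex.norm_real, Real.norm_eq_abs,
      sq_abs, ← mul_assoc, hβ0, sq]
  refine ⟨α, β, _, hm, ?_, ?_, ?_⟩
  · intro i
    fin_cases i
    exacts [hα0, hm.fst_one_ne_zero h hp]
  · intro i
    fin_cases i
    -- A vanishing zeroth coordinate of one factor forces the same for the cyclically next one, and
    -- eventually for α.
    · intro h0
      exact hα0 (hm.rot.rot.snd_eq_zero (Theta_rot (Theta_rot h)) hp.rot.rot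
        (hm.rot.snd_eq_zero (Theta_rot h) hp.rot h0))
    · exact hm.rot.fst_one_ne_zero (Theta_rot h) hp.rot
  · intro i
    fin_cases i
    · intro h0
      exact hα0 (hm.rot.rot.snd_eq_zero (Theta_rot (Theta_rot h)) hp.rot.rot h0)
    · exact hm.rot.rot.fst_one_ne_zero (Theta_rot (Theta_rot h)) hp.rot.rot

end Theta

/-! ### The invariants determine the canonical form up to the sign of `y` -/

/-- After clearing denominators, the conclusion is exactly the hypothesis `h`. -/
lemma sum_div_le_one {A B C s : ℝ} (hA : 0 ≤ A) (hB : 0 ≤ B) (hC : 0 ≤ C) (hs : 0 < s)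
    (h : 4 * (A * B * C) ≤ s ^ 2 * (s + (A + B + C))) :
    A / (2 * A + s) + B / (2 * B + s) + C / (2 * C + s) ≤ 1 := by
  have h1 : 0 < 2 * A + s := by positivity
  have h2 : 0 < 2 * B + s := by positivity
  have h3 : 0 < 2 * C + s := by positivity
  rw [div_add_div _ _ h1.ne' h2.ne', div_add_div _ _ (by positivity) h3.ne',
    div_le_one (by positivity)]
  nlinarith

/-- Put δ = s' - s and write A - A' = δx, and likewise with y and z for B and C. Equality of the
sums gives x + y + z = 1. The quadratic relations give x ≤ A/(2A + s), strictly unless x = 0, so by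
`sum_div_le_one` the sum is less than 1. -/
lemma not_lt_of_invariants {A B C A' B' C' s s' : ℝ} (hA : 0 ≤ A) (hB : 0 ≤ B) (hC : 0 ≤ C)
    (hA' : 0 ≤ A') (hB' : 0 ≤ B') (hC' : 0 ≤ C') (hs : 0 ≤ s)
    (hsum : s + (A + B + C) = s' + (A' + B' + C'))
    (eA : A * (A + s) = A' * (A' + s')) (eB : B * (B + s) = B' * (B' + s'))
    (eC : C * (C + s) = C' * (C' + s'))
    (h : 4 * (A * B * C) ≤ s ^ 2 * (s + (A + B + C))) : ¬ s < s' := by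
  intro hlt
  obtain ⟨δ, hδ⟩ : ∃ δ, δ = s' - s := ⟨_, rfl⟩
  have hδ0 : 0 < δ := by linarith
  have key : ∀ X X' : ℝ, 0 ≤ X → 0 ≤ X' → X * (X + s) = X' * (X' + s') →
      ∃ t, 0 ≤ t ∧ t < 1 ∧ X - X' = δ * t ∧ t * (2 * X + s) + δ * (t * (1 - t)) = X := by
    intro X X' hX hX' e
    have hp : 0 < X + X' + s' := by linarith
    have e1 : X - X' = δ * (X / (X + X' + s')) := by
      rw [hδ]; field_simp; linarith
    have e2 : X / (X + X' + s') * (X + X' + s') = X := div_mul_cancel₀ _ hp.ne'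
    refine ⟨X / (X + X' + s'), by positivity, (div_lt_one hp).2 (by linarith), e1, ?_⟩
    generalize X / (X + X' + s') = t at e1 e2
    have hX'e : X' = X - δ * t := by linarith
    have hs'e : s' = s + δ := by linarith
    rw [hX'e, hs'e] at e2
    linarith
  obtain ⟨x, hx0, hx1, hx2, hx3⟩ := key A A' hA hA' eA
  obtain ⟨y, hy0, hy1, hy2, hy3⟩ := key B B' hB hB' eB
  obtain ⟨z, hz0, hz1, hz2, hz3⟩ := key C C' hC hC' eC
  have hxyz : x + y + z = 1 := by
    have : δ * (x + y + z) = δ * 1 := by linarith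
    exact mul_left_cancel₀ hδ0.ne' this
  rcases hs.eq_or_lt with h0 | hs0
  -- For s = 0 the hypothesis says ABC = 0: each of x, y, z is below 1/2 and one of them vanishes,
  -- so the sum cannot be 1.
  · have half : ∀ X t : ℝ, 0 ≤ X → 0 ≤ t → t < 1 → t * (2 * X + s) + δ * (t * (1 - t)) = X →
        t < 1 / 2 ∧ (X = 0 → t = 0) := by
      intro X t hX ht0 ht1 e
      have zero : X = 0 → t = 0 := by
        intro hX0
        rw [hX0, ← h0] at e
        have : δ * (t * (1 - t)) = 0 := by linarith
        rcases mul_eq_zero.1 this with h | h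
        · exact absurd h hδ0.ne'
        · rcases mul_eq_zero.1 h with h | h
          · exact h
          · linarith
      refine ⟨?_, zero⟩
      by_contra ht
      push Not at ht
      have : 0 < δ * (t * (1 - t)) :=
        mul_pos hδ0 (mul_pos (by linarith) (by linarith))
      nlinarith [mul_nonneg hX (show 0 ≤ 2 * t - 1 by linarith)]
    rw [← h0] at h
    have habc : A * B * C = 0 := by
      have : 0 ≤ A * B * C := by positivity
      linarith
    obtain ⟨hx4, hx5⟩ := half A x hA hx0 hx1 hx3
    obtain ⟨hy4, hy5⟩ := half B y hB hy0 hy1 hy3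
    obtain ⟨hz4, hz5⟩ := half C z hC hz0 hz1 hz3
    rcases mul_eq_zero.1 habc with h | h
    · rcases mul_eq_zero.1 h with h | h
      · linarith [hx5 h]
      · linarith [hy5 h]
    · linarith [hz5 h]
  · have hle := sum_div_le_one hA hB hC hs0 h
    have bound : ∀ X t : ℝ, 0 ≤ X → 0 ≤ t → t < 1 →
        t * (2 * X + s) + δ * (t * (1 - t)) = X →
        t ≤ X / (2 * X + s) ∧ (t ≠ 0 → t < X / (2 * X + s)) := by
      intro X t hX ht0 ht1 e
      have hp : 0 < 2 * X + s := by positivity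
      constructor
      · rw [le_div_iff₀ hp]
        have : 0 ≤ δ * (t * (1 - t)) :=
          mul_nonneg hδ0.le (mul_nonneg ht0 (by linarith))
        linarith
      · intro ht
        rw [lt_div_iff₀ hp]
        have : 0 < δ * (t * (1 - t)) :=
          mul_pos hδ0 (mul_pos (ht0.lt_of_ne' ht) (by linarith))
        linarith
    obtain ⟨hx4, hx5⟩ := bound A x hA hx0 hx1 hx3
    obtain ⟨hy4, hy5⟩ := bound B y hB hy0 hy1 hy3
    obtain ⟨hz4, hz5⟩ := bound C z hC hz0 hz1 hz3
    by_cases hx : x = 0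
    · by_cases hy : y = 0
      · have hz : z ≠ 0 := by intro hz; linarith
        linarith [hz5 hz]
      · linarith [hy5 hy]
    · linarith [hx5 hx]

lemma eq_of_invariants {A B C A' B' C' s s' : ℝ} (hA : 0 ≤ A) (hB : 0 ≤ B) (hC : 0 ≤ C)
    (hA' : 0 ≤ A') (hB' : 0 ≤ B') (hC' : 0 ≤ C') (hs : 0 ≤ s) (hs' : 0 ≤ s')
    (hsum : s + (A + B + C) = s' + (A' + B' + C'))
    (eA : A * (A + s) = A' * (A' + s')) (eB : B * (B + s) = B' * (B' + s'))
    (eC : C * (C + s) = C' * (C' + s'))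
    (h : 4 * (A * B * C) ≤ s ^ 2 * (s + (A + B + C)))
    (h' : 4 * (A' * B' * C') ≤ s' ^ 2 * (s' + (A' + B' + C'))) : A = A' ∧ B = B' ∧ C = C' := by
  have hss : s = s' := le_antisymm
    (not_lt.1 (not_lt_of_invariants hA' hB' hC' hA hB hC hs' hsum.symm eA.symm eB.symm eC.symm h'))
    (not_lt.1 (not_lt_of_invariants hA hB hC hA' hB' hC' hs hsum eA eB eC h))
  have key : ∀ X X' : ℝ, 0 ≤ X → 0 ≤ X' → X * (X + s) = X' * (X' + s') → X = X' := by
    intro X X' hX hX' e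
    have : (X - X') * (X + X' + s) = 0 := by rw [← hss] at e; linarith
    rcases mul_eq_zero.1 this with h | h <;> linarith
  exact ⟨key _ _ hA hA' eA, key _ _ hB hB' eB, key _ _ hC hC' eC⟩

/-! ### Comparison of LU-equivalent points of `Theta` -/

section Theta

variable {p q : Point}

lemma Theta_norm (h : p ∈ Theta) : p.a ^ 2 + p.b ^ 2 + p.c ^ 2 + p.d ^ 2 + ‖p.z‖ ^ 2 = 1 :=
  ((mem_Theta_iff p).1 h).1

lemma Theta_d_le (hp : p ∈ Theta) (hq : q ∈ Theta) (e : LUEquiv (qubitState p) (qubitState q)) :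
    q.d ≤ p.d := by
  have h := ((mem_Theta_iff p).1 hp).2.2.2.2.2.2.of_LUEquiv e (Pi.single 1 1) (Pi.single 1 1)
    (Pi.single 1 1)
  rw [contract_apply_single, qubitState_apply] at h
  simp only [nsq] at h
  simp at h
  exact (sq_le_sq₀ (Theta_d_pos hq).le (Theta_d_pos hp).le).1 h

/-- Eliminating |z|² by the normalization turns the reduced determinant into d² - d⁴ - a²(a² + d² -
s₁), and d is common to both points. -/
lemma Theta_invariant_eq (hp : p ∈ Theta) (hq : q ∈ Theta) (hd : q.d = p.d)
    (e : LUEquiv (qubitState p) (qubitState q)) :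
    p.a ^ 2 * (p.a ^ 2 + (p.d ^ 2 - (p.a ^ 2 + p.b ^ 2 + p.c ^ 2))) =
      q.a ^ 2 * (q.a ^ 2 + (q.d ^ 2 - (q.a ^ 2 + q.b ^ 2 + q.c ^ 2))) := by
  have h := e.redDet_eq
  rw [redDet_qubitState, redDet_qubitState, Complex.ofReal_inj] at h
  have np := Theta_norm hp
  have nq := Theta_norm hq
  rw [show ‖p.z‖ ^ 2 = 1 - (p.a ^ 2 + p.b ^ 2 + p.c ^ 2 + p.d ^ 2) by linarith,
    show ‖q.z‖ ^ 2 = 1 - (q.a ^ 2 + q.b ^ 2 + q.c ^ 2 + q.d ^ 2) by linarith] at h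
  rw [hd] at h ⊢
  linarith

/-- The square of 2abc ≤ d(d² - s₁), which is `0 ≤ curvRe` divided by d. -/
lemma Theta_four_mul_le (h : p ∈ Theta) : 4 * (p.a ^ 2 * p.b ^ 2 * p.c ^ 2) ≤
    (p.d ^ 2 - (p.a ^ 2 + p.b ^ 2 + p.c ^ 2)) ^ 2 *
      (p.d ^ 2 - (p.a ^ 2 + p.b ^ 2 + p.c ^ 2) + (p.a ^ 2 + p.b ^ 2 + p.c ^ 2)) := by
  have hd := Theta_d_pos h
  have h1 := (Theta_curvRe h).1
  rw [mem_Theta_iff] at h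
  obtain ⟨hs, ha, hb, hc, -, hx, hB⟩ := h
  unfold Point.curvRe at h1
  have h2 : 0 ≤ p.d * (p.d * (p.d ^ 2 - (p.a ^ 2 + p.b ^ 2 + p.c ^ 2)) -
    2 * (p.a * p.b * p.c)) := by linarith
  have h3 := nonneg_of_mul_nonneg_right h2 hd
  have h4 : 2 * (p.a * p.b * p.c) ≤ p.d * (p.d ^ 2 - (p.a ^ 2 + p.b ^ 2 + p.c ^ 2)) := by linarith
  have h5 := pow_le_pow_left₀ (by positivity) h4 2
  linarith

/-- LU-equivalent canonical states have the same parameters up to the phase of `z`. -/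
lemma Theta_abcd_eq (hp : p ∈ Theta) (hq : q ∈ Theta)
    (e : LUEquiv (qubitState p) (qubitState q)) :
    q.a = p.a ∧ q.b = p.b ∧ q.c = p.c ∧ q.d = p.d ∧ q.x ^ 2 + q.y ^ 2 = p.x ^ 2 + p.y ^ 2 := by
  have hd : q.d = p.d := le_antisymm (Theta_d_le hp hq e) (Theta_d_le hq hp e.symm)
  have e1 : LUEquiv (qubitState p.rot) (qubitState q.rot) := by
    rw [← rot_qubitState, ← rot_qubitState]; exact e.rot
  have e2 : LUEquiv (qubitState p.rot.rot) (qubitState q.rot.rot) := by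
    rw [← rot_qubitState p.rot, ← rot_qubitState q.rot]; exact e1.rot
  have eA := Theta_invariant_eq hp hq hd e
  have eB := Theta_invariant_eq (Theta_rot hp) (Theta_rot hq) hd e1
  have eC := Theta_invariant_eq (Theta_rot (Theta_rot hp)) (Theta_rot (Theta_rot hq)) hd e2
  simp only [Point.rot_a, Point.rot_b, Point.rot_c, Point.rot_d] at eB eC
  have h := eq_of_invariants (sq_nonneg p.a) (sq_nonneg p.b) (sq_nonneg p.c) (sq_nonneg q.a)
    (sq_nonneg q.b) (sq_nonneg q.c) (sub_nonneg.2 (Theta_sum_le hp))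
    (sub_nonneg.2 (Theta_sum_le hq)) (by rw [hd]; ring) eA (by linarith) (by linarith)
    (Theta_four_mul_le hp) (Theta_four_mul_le hq)
  have np := Theta_norm hp
  have nq := Theta_norm hq
  rw [Point.norm_z_sq] at np nq
  obtain ⟨hA, hB, hC⟩ := h
  have hz : q.x ^ 2 + q.y ^ 2 = p.x ^ 2 + p.y ^ 2 := by
    rw [hd] at nq
    linarith
  obtain ⟨-, pa, pb, pc, -⟩ := (mem_Theta_iff p).1 hp
  obtain ⟨-, qa, qb, qc, -⟩ := (mem_Theta_iff q).1 hq
  exact ⟨(pow_left_inj₀ qa pa two_ne_zero).1 hA.symm, (pow_left_inj₀ qb pb two_ne_zero).1 hB.symm,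
    (pow_left_inj₀ qc pc two_ne_zero).1 hC.symm, hd, hz⟩

lemma norm_hyperdet_qubitState_sq (p : Point) :
    ‖hyperdet fun i j k => qubitState p (i, j, k)‖ ^ 2 =
      p.d ^ 4 * (p.x ^ 2 + p.y ^ 2) ^ 2 + 8 * (p.a * p.b * p.c * p.d ^ 3) * (p.x ^ 2 - p.y ^ 2) +
        16 * (p.a * p.b * p.c * p.d) ^ 2 := by
  rw [hyperdet_qubitState, Complex.sq_norm, Complex.normSq_apply]
  simp [← Complex.ofReal_pow, sq p.z, Point.x, Point.y]
  ring

/-- LU-equivalent canonical states with `abc ≠ 0` have the same parameters up to the sign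
of `y`. -/
lemma Theta_xy_eq (hp : p ∈ Theta) (hq : q ∈ Theta) (e : LUEquiv (qubitState p) (qubitState q))
    (h0 : p.a * p.b * p.c ≠ 0) : q.x = p.x ∧ q.y ^ 2 = p.y ^ 2 := by
  obtain ⟨ha, hb, hc, hd, hz⟩ := Theta_abcd_eq hp hq e
  -- With |z| known, the modulus of the hyperdeterminant sees the phase of z only through abcd³(x² -
  -- y²).
  have h := congrArg (· ^ 2) e.norm_hyperdet_eq
  simp only [norm_hyperdet_qubitState_sq, ha, hb, hc, hd, hz] at h
  have hd0 := Theta_d_pos hp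
  have h1 : p.a * p.b * p.c * p.d ^ 3 ≠ 0 := mul_ne_zero h0 (by positivity)
  have h2 : q.x ^ 2 - q.y ^ 2 = p.x ^ 2 - p.y ^ 2 := by
    refine mul_left_cancel₀ h1 ?_
    linarith
  have hx : q.x ^ 2 = p.x ^ 2 := by linarith
  refine ⟨(pow_left_inj₀ ?_ ?_ two_ne_zero).1 hx, by linarith⟩
  · exact ((mem_Theta_iff q).1 hq).2.2.2.2.2.1
  · exact ((mem_Theta_iff p).1 hp).2.2.2.2.2.1

lemma mem_Theta_of_LUEquiv (hp : p ∈ Theta) (e : LUEquiv (qubitState p) (qubitState q))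
    (ha : 0 ≤ q.a) (hb : 0 ≤ q.b) (hc : 0 ≤ q.c) (hd : q.d = p.d) (hx : 0 ≤ q.x) : q ∈ Theta := by
  rw [mem_Theta_iff, mem_sphere_iff] at hp ⊢
  obtain ⟨hs, -, -, -, h0, -, hB⟩ := hp
  exact ⟨e.norm_eq.trans hs, ha, hb, hc, hd ▸ h0, hx, hd ▸ hB.of_LUEquiv e⟩

end Theta

/-! ### Diagonal unitaries -/

lemma diagonal_mem_unitaryGroup {u v : ℂ} (hu : ‖u‖ = 1) (hv : ‖v‖ = 1) :
    Matrix.diagonal ![u, v] ∈ Matrix.unitaryGroup (Fin 2) ℂ := by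
  rw [Matrix.mem_unitaryGroup_iff, Matrix.star_eq_conjTranspose, Matrix.diagonal_conjTranspose,
    Matrix.diagonal_mul_diagonal, ← Matrix.diagonal_one]
  congr 1
  ext i
  fin_cases i <;> simp [Complex.mul_conj', hu, hv]

/-- A state whose coefficients at `|011⟩, |101⟩, |110⟩` vanish can be brought by diagonal unitaries
into canonical form. -/
lemma LUEquiv_qubitState_of_phases {φ : QubitSpace} (h1 : φ (0, 1, 1) = 0) (h2 : φ (1, 0, 1) = 0)
    (h3 : φ (1, 1, 0) = 0) {p : Point} {g u v w t : ℂ} (hg : ‖g‖ = 1) (hu : ‖u‖ = 1)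
    (hv : ‖v‖ = 1) (hw : ‖w‖ = 1) (ht : t * g ^ 2 = u * v * w)
    (ha : u * φ (1, 0, 0) = p.a) (hb : v * φ (0, 1, 0) = p.b) (hc : w * φ (0, 0, 1) = p.c)
    (hd : t * φ (1, 1, 1) = p.d) (hz : g * φ (0, 0, 0) = p.z) : LUEquiv φ (qubitState p) := by
  have hg0 : g ≠ 0 := norm_ne_zero_iff.1 (by rw [hg]; exact one_ne_zero)
  have ht' : t = u * v * w / g ^ 2 := by field_simp; exact ht
  -- With these entries |000⟩, |100⟩, |010⟩, |001⟩ get the factors g, u, v, w, and |111⟩ gets uvw/g²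
  -- = t.
  refine LUEquiv_iff.2 ⟨_, diagonal_mem_unitaryGroup hg hu, _,
    diagonal_mem_unitaryGroup (u := 1) (v := v / g) (by simp) (by simp [hv, hg]), _,
    diagonal_mem_unitaryGroup (u := 1) (v := w / g) (by simp) (by simp [hw, hg]), ?_⟩
  ext ⟨i, j, k⟩
  rw [localAct_apply, qubitState_apply]
  fin_cases i <;> fin_cases j <;> fin_cases k <;>
    simp [contract, Matrix.diagonal, h1, h2, h3, ← ha, ← hb, ← hc, ← hd, ← hz,
      ht'] <;> field_simp <;> simp

lemma LUEquiv_smul {e : ℂ} (he : ‖e‖ = 1) (φ : QubitSpace) : LUEquiv φ (e • φ) := by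
  refine LUEquiv_iff.2 ⟨_, diagonal_mem_unitaryGroup he he, 1, one_mem _, 1, one_mem _, ?_⟩
  ext ⟨i, j, k⟩
  rw [localAct_apply]
  fin_cases i <;> fin_cases j <;> fin_cases k <;>
    simp [contract, Matrix.diagonal, Matrix.one_apply]

/-! ### Existence of a canonical form -/

lemma exists_phase_mul_eq_norm (w : ℂ) : ∃ e : ℂ, ‖e‖ = 1 ∧ e * w = ‖w‖ := by
  by_cases h : w = 0
  · exact ⟨1, by simp, by simp [h]⟩
  · have hw : (‖w‖ : ℂ) ≠ 0 := by exact_mod_cast norm_ne_zero_iff.2 h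
    refine ⟨star w / ‖w‖, ?_, ?_⟩
    · simp [norm_ne_zero_iff.2 h]
    · rw [div_mul_eq_mul_div, mul_comm, Complex.star_def, Complex.mul_conj', sq, mul_div_assoc,
        div_self hw, mul_one]

lemma exists_sq_eq_of_norm_eq_one {w : ℂ} (hw : ‖w‖ = 1) (t : ℂ) :
    ∃ g : ℂ, ‖g‖ = 1 ∧ g ^ 2 = w ∧ 0 ≤ (g * t).re := by
  obtain ⟨g, hg⟩ := IsAlgClosed.exists_pow_nat_eq w (n := 2) two_pos
  have hn : ‖g‖ = 1 := by
    rw [← pow_eq_one_iff_of_nonneg (norm_nonneg _) two_ne_zero, ← norm_pow, hg, hw]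
  rcases le_total 0 (g * t).re with h | h
  · exact ⟨g, hn, hg, h⟩
  · exact ⟨-g, by rwa [norm_neg], by rwa [neg_sq], by rw [neg_mul, Complex.neg_re]; linarith⟩

lemma isCompact_nsq_eq_one : IsCompact {α : Fin 2 → ℂ | nsq α = 1} := by
  refine Metric.isCompact_of_isClosed_isBounded ?_ ?_
  · exact isClosed_eq (by unfold nsq; fun_prop) continuous_const
  · refine (Metric.isBounded_closedBall (x := (0 : Fin 2 → ℂ)) (r := 1)).subset fun α hα => ?_
    rw [mem_closedBall_zero_iff, pi_norm_le_iff_of_nonneg zero_le_one]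
    have h : ‖α 0‖ ^ 2 + ‖α 1‖ ^ 2 = 1 := hα
    intro i
    rw [← sq_le_one_iff₀ (norm_nonneg _)]
    fin_cases i
    · simpa using by nlinarith [sq_nonneg ‖α 1‖]
    · simpa using by nlinarith [sq_nonneg ‖α 0‖]

lemma exists_max_overlap (φ : QubitSpace) : ∃ α β γ : Fin 2 → ℂ, nsq α = 1 ∧ nsq β = 1 ∧
    nsq γ = 1 ∧ OverlapBound φ ‖contract φ α β γ‖ := by
  have hK := isCompact_nsq_eq_one
  have h1 : Pi.single 1 1 ∈ {α : Fin 2 → ℂ | nsq α = 1} := by simp [nsq]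
  obtain ⟨⟨α, β, γ⟩, ⟨hα, hβ, hγ⟩, hmax⟩ := (hK.prod (hK.prod hK)).exists_isMaxOn
    ⟨(_, _, _), h1, h1, h1⟩
    (f := fun m : (Fin 2 → ℂ) × (Fin 2 → ℂ) × (Fin 2 → ℂ) => ‖contract φ m.1 m.2.1 m.2.2‖)
    (Continuous.continuousOn (by unfold contract; fun_prop))
  exact ⟨α, β, γ, hα, hβ, hγ, overlapBound_of_unit fun α' β' γ' hα' hβ' hγ' =>
    hmax (a := (α', β', γ')) ⟨hα', hβ', hγ'⟩⟩

lemma exists_unitary_row {α : Fin 2 → ℂ} (hα : nsq α = 1) :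
    ∃ U ∈ Matrix.unitaryGroup (Fin 2) ℂ, U 1 = α := by
  have h : α 0 * star (α 0) + α 1 * star (α 1) = 1 := by
    have := ofReal_nsq α
    rw [hα] at this
    simpa [dotProduct, Fin.sum_univ_two] using this.symm
  refine ⟨!![-star (α 1), star (α 0); α 0, α 1], ?_, ?_⟩
  · rw [Matrix.mem_unitaryGroup_iff]
    simp only [Complex.star_def] at h
    ext i j
    fin_cases i <;> fin_cases j <;>
      simp [Matrix.mul_apply, Fin.sum_univ_two, Matrix.star_apply]
    · linear_combination h
    · ring
    · ring
    · exact h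
  · ext i
    fin_cases i <;> rfl

/-- Contracting the first qubit with the conjugate of its own coefficient vector gives overlap N =
|φ₀₁₁|² + |φ₁₁₁|², and the bound N² ≤ |φ₁₁₁|²N forces φ₀₁₁ = 0. -/
lemma apply_011_eq_zero {φ : QubitSpace} (h : OverlapBound φ ‖φ (1, 1, 1)‖) :
    φ (0, 1, 1) = 0 := by
  have h1 := h (star ![φ (0, 1, 1), φ (1, 1, 1)]) (Pi.single 1 1) (Pi.single 1 1)
  have e : contract φ (star ![φ (0, 1, 1), φ (1, 1, 1)]) (Pi.single 1 1) (Pi.single 1 1) =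
      ((‖φ (0, 1, 1)‖ ^ 2 + ‖φ (1, 1, 1)‖ ^ 2 : ℝ) : ℂ) := by
    simp [contract, Fin.sum_univ_two, ← Complex.conj_mul']
  rw [e, Complex.norm_real, Real.norm_eq_abs, sq_abs] at h1
  simp only [nsq] at h1
  simp at h1
  have h2 : ‖φ (0, 1, 1)‖ ^ 2 = 0 := by
    nlinarith [sq_nonneg ‖φ (0, 1, 1)‖, sq_nonneg ‖φ (1, 1, 1)‖,
      mul_nonneg (sq_nonneg ‖φ (0, 1, 1)‖) (sq_nonneg ‖φ (1, 1, 1)‖)]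
  simpa using h2

lemma apply_eq_zero_of_overlapBound {φ : QubitSpace} (h : OverlapBound φ ‖φ (1, 1, 1)‖) :
    φ (0, 1, 1) = 0 ∧ φ (1, 0, 1) = 0 ∧ φ (1, 1, 0) = 0 :=
  ⟨apply_011_eq_zero h, apply_011_eq_zero (φ := rot φ) h.rot,
    apply_011_eq_zero (φ := rot (rot φ)) h.rot.rot⟩

theorem exists_mem_Theta {φ : QubitSpace} (hφ : ‖φ‖ = 1) :
    ∃ p ∈ Theta, LUEquiv φ (qubitState p) := by
  obtain ⟨α, β, γ, hα, hβ, hγ, hmax⟩ := exists_max_overlap φ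
  obtain ⟨U, hU, rfl⟩ := exists_unitary_row hα
  obtain ⟨V, hV, rfl⟩ := exists_unitary_row hβ
  obtain ⟨W, hW, rfl⟩ := exists_unitary_row hγ
  have e : LUEquiv φ (localAct U V W φ) := LUEquiv_iff.2 ⟨U, hU, V, hV, W, hW, rfl⟩
  rw [← localAct_apply] at hmax
  have hmax' := hmax.of_LUEquiv e
  generalize localAct U V W φ = ψ at e hmax'
  obtain ⟨h1, h2, h3⟩ := apply_eq_zero_of_overlapBound hmax'
  obtain ⟨u, hu, hu'⟩ := exists_phase_mul_eq_norm (ψ (1, 0, 0))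
  obtain ⟨v, hv, hv'⟩ := exists_phase_mul_eq_norm (ψ (0, 1, 0))
  obtain ⟨w, hw, hw'⟩ := exists_phase_mul_eq_norm (ψ (0, 0, 1))
  obtain ⟨t, ht, ht'⟩ := exists_phase_mul_eq_norm (ψ (1, 1, 1))
  have ht0 : t ≠ 0 := norm_ne_zero_iff.1 (by rw [ht]; exact one_ne_zero)
  -- The phases of a, b, c, d determine g only up to sign; the sign is chosen to make x ≥ 0.
  obtain ⟨g, hg, hg2, hg'⟩ := exists_sq_eq_of_norm_eq_one (w := u * v * w / t)
    (by simp [hu, hv, hw, ht]) (ψ (0, 0, 0))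
  let p : Point := (![‖ψ (1, 0, 0)‖, ‖ψ (0, 1, 0)‖, ‖ψ (0, 0, 1)‖], ‖ψ (1, 1, 1)‖,
    g * ψ (0, 0, 0))
  have e' : LUEquiv ψ (qubitState p) :=
    LUEquiv_qubitState_of_phases h1 h2 h3 hg hu hv hw (by rw [hg2]; field_simp) hu' hv' hw' ht' rfl
  refine ⟨p, ?_, e.trans e'⟩
  rw [mem_Theta_iff, mem_sphere_iff]
  exact ⟨(e.trans e').norm_eq.trans hφ, norm_nonneg _, norm_nonneg _, norm_nonneg _,
    norm_nonneg _, hg', hmax'.of_LUEquiv e'⟩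

/-! ### Uniqueness in the interior -/

lemma contract_row {U V W : Matrix (Fin 2) (Fin 2) ℂ} {φ : QubitSpace} :
    contract φ (U 1) (V 1) (W 1) = localAct U V W φ (1, 1, 1) := (localAct_apply _ _ _ _ _ _ _).symm

lemma nsq_row {U : Matrix (Fin 2) (Fin 2) ℂ} (hU : U ∈ Matrix.unitaryGroup (Fin 2) ℂ)
    (i : Fin 2) : nsq (U i) = 1 := by
  have h := congrFun (congrFun (Matrix.mem_unitaryGroup_iff.1 hU) i) i
  rw [Matrix.one_apply_eq, Matrix.mul_apply] at h
  have h2 := ofReal_nsq (U i)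
  have h3 : ((nsq (U i) : ℝ) : ℂ) = 1 := h2.trans h
  exact_mod_cast h3

lemma unitary_apply_zero_one {U : Matrix (Fin 2) (Fin 2) ℂ}
    (hU : U ∈ Matrix.unitaryGroup (Fin 2) ℂ) (h : U 1 0 = 0) : U 0 1 = 0 := by
  have h1 := congrFun (congrFun (Matrix.mem_unitaryGroup_iff.1 hU) 0) 1
  have h2 := congrFun (congrFun (Matrix.mem_unitaryGroup_iff.1 hU) 1) 1
  simp [Matrix.mul_apply, Fin.sum_univ_two, Matrix.star_apply, h] at h1 h2
  rcases h1 with h1 | h1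
  · exact h1
  · simp [h1] at h2

section Theta

variable {p q : Point}

theorem eq_of_LUEquiv_of_Phi_pos (hp : p ∈ Theta) (hpos : p.Positive) (hΦ : 0 < Phi p)
    (hq : q ∈ Theta) (e : LUEquiv (qubitState p) (qubitState q)) : q = p := by
  obtain ⟨ha, hb, hc, hd, -⟩ := Theta_abcd_eq hp hq e
  have hd0 := Theta_d_pos hp
  have hqx : 0 ≤ q.x := ((mem_Theta_iff q).1 hq).2.2.2.2.2.1
  obtain ⟨U, hU, V, hV, W, hW, hact⟩ := LUEquiv_iff.1 e
  have hne : ∀ {U : Matrix (Fin 2) (Fin 2) ℂ}, U ∈ Matrix.unitaryGroup (Fin 2) ℂ → U 1 ≠ 0 := by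
    intro U hU h0
    have := nsq_row hU 1
    rw [h0] at this
    simp [nsq] at this
  have hm : IsMaximizer (qubitState p) p.d (U 1) (V 1) (W 1) := by
    refine ⟨hne hU, hne hV, hne hW, ?_⟩
    rw [contract_row, ← hact, qubitState_apply, nsq_row hU, nsq_row hV, nsq_row hW]
    simp [hd]
  obtain ⟨hU0, hV0, hW0⟩ := hm.eq_zero hp hpos hΦ
  have hU1 := unitary_apply_zero_one hU hU0
  have hV1 := unitary_apply_zero_one hV hV0
  have hW1 := unitary_apply_zero_one hW hW0
  have hcoord : ∀ i j k, qubitState q (i, j, k) =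
      contract (qubitState p) (U i) (V j) (W k) := by
    intro i j k
    rw [hact, localAct_apply]
  have ea := hcoord 1 0 0
  have eb := hcoord 0 1 0
  have ec := hcoord 0 0 1
  have ed := hcoord 1 1 1
  have ez := hcoord 0 0 0
  rw [qubitState_apply, contract_qubitState, hU0, hV0, hW0] at ed
  rw [qubitState_apply, contract_qubitState, hU0, hV1, hW1] at ea
  rw [qubitState_apply, contract_qubitState, hU1, hV0, hW1] at eb
  rw [qubitState_apply, contract_qubitState, hU1, hV1, hW0] at ec
  rw [qubitState_apply, contract_qubitState, hU1, hV1, hW1] at ez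
  simp only [ha, hb, hc, hd, mul_zero, zero_mul, add_zero, zero_add, Matrix.cons_val_zero,
    Matrix.cons_val_one] at ea eb ec ed ez
  obtain ⟨pa, pb, pc, px⟩ := hpos
  have one_of : ∀ {r : ℝ} {t : ℂ}, 0 < r → (r : ℂ) = r * t → t = 1 := by
    intro r t hr h
    have hr' : (r : ℂ) ≠ 0 := by exact_mod_cast hr.ne'
    exact mul_left_cancel₀ hr' (by rw [mul_one]; exact h.symm)
  have fa := one_of pa ea
  have fb := one_of pb eb
  have fc := one_of pc ec
  have fd := one_of hd0 ed
  -- The phases at |100⟩, |010⟩, |001⟩, |111⟩ are all 1, and combining them pins down the square of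
  -- the phase of z.
  have hsq : (U 0 0 * V 0 0 * W 0 0) ^ 2 = 1 := by
    calc (U 0 0 * V 0 0 * W 0 0) ^ 2
        = (U 0 0 * V 0 0 * W 0 0) ^ 2 * (U 1 1 * V 1 1 * W 1 1) := by rw [fd, mul_one]
      _ = (U 1 1 * V 0 0 * W 0 0) * (U 0 0 * V 1 1 * W 0 0) * (U 0 0 * V 0 0 * W 1 1) := by ring
      _ = 1 := by rw [fa, fb, fc]; norm_num
  have hz : q.z = p.z := by
    rcases (sq_eq_one_iff.1 hsq) with h | h
    · rw [ez, h, mul_one]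
    · exfalso
      rw [h] at ez
      have : q.x = -p.x := by
        simp [Point.x, ez]
      linarith
  exact Point.ext_coords ha hb hc hd hz

/-! ### The boundary -/

/-- The complex conjugate of a parameter point. -/
def Point.conj (p : Point) : Point := (p.1, p.2.1, star p.2.2)

/-- A symmetric unitary matrix whose second row is proportional to a given vector. -/
lemma exists_symm_unitary {α : Fin 2 → ℂ} (hα : ∀ i, α i ≠ 0) :
    ∃ U ∈ Matrix.unitaryGroup (Fin 2) ℂ, U.transpose = U ∧ U 1 0 ≠ 0 ∧
      ∃ t : ℂ, U 1 = t • α := by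
  obtain ⟨s, hs⟩ : ∃ s, s = α 0 / α 1 := ⟨_, rfl⟩
  have hs0 : s ≠ 0 := hs ▸ div_ne_zero (hα 0) (hα 1)
  have hs0' : star s ≠ 0 := star_ne_zero.2 hs0
  obtain ⟨n, hn⟩ : ∃ n : ℝ, n = (√(1 + ‖s‖ ^ 2))⁻¹ := ⟨_, rfl⟩
  have hpos : 0 < 1 + ‖s‖ ^ 2 := by positivity
  have hn0 : (n : ℂ) ≠ 0 := by
    rw [hn]
    exact_mod_cast inv_ne_zero (Real.sqrt_ne_zero'.2 hpos)
  have hn2 : (n : ℂ) * n * (1 + s * star s) = 1 := by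
    have h1 : n * n * (1 + ‖s‖ ^ 2) = 1 := by
      rw [hn, ← mul_inv, Real.mul_self_sqrt hpos.le, inv_mul_cancel₀ hpos.ne']
    rw [Complex.star_def, Complex.mul_conj']
    exact_mod_cast h1
  -- The second row is (s, 1) normalized, symmetry fixes the upper right entry, and orthogonality of
  -- the rows fixes the upper left one.
  refine ⟨!![-(n * (s / star s)), n * s; n * s, n], ?_, ?_, ?_, n / α 1, ?_⟩
  · rw [Matrix.mem_unitaryGroup_iff]
    simp only [Complex.star_def] at hn2 hs0' ⊢
    ext i j
    fin_cases i <;> fin_cases j <;>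
      simp [Matrix.mul_apply, Fin.sum_univ_two, Matrix.star_apply] <;> field_simp
    · linear_combination hn2
    · ring
    · ring
    · linear_combination hn2
  · ext i j
    fin_cases i <;> fin_cases j <;> rfl
  · simpa using And.intro (Complex.ofReal_ne_zero.1 hn0) hs0
  · have h1 := hα 1
    ext i
    fin_cases i
    · simp [hs]; field_simp
    · simp; field_simp

/-- The vector with complex conjugate coefficients. -/
noncomputable def conjState (φ : QubitSpace) : QubitSpace := WithLp.toLp 2 fun m => star (φ m)

lemma conjState_apply (φ : QubitSpace) (m : Fin 2 × Fin 2 × Fin 2) :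
    conjState φ m = star (φ m) := rfl

lemma conjState_qubitState (p : Point) : conjState (qubitState p) = qubitState p.conj := by
  ext ⟨i, j, k⟩
  rw [conjState_apply, qubitState_apply, qubitState_apply]
  fin_cases i <;> fin_cases j <;> fin_cases k <;>
    simp [Point.conj, Point.a, Point.b, Point.c, Point.d, Point.z]

lemma conjState_localAct (U V W : Matrix (Fin 2) (Fin 2) ℂ) (φ : QubitSpace) :
    conjState (localAct U V W φ) = localAct (U.map star) (V.map star) (W.map star)
      (conjState φ) := by
  ext ⟨i, j, k⟩
  rw [conjState_apply, localAct_apply, localAct_apply]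
  simp [contract, conjState_apply]

lemma mul_map_star_of_symm {U : Matrix (Fin 2) (Fin 2) ℂ}
    (hU : U ∈ Matrix.unitaryGroup (Fin 2) ℂ) (h : U.transpose = U) : U * U.map star = 1 := by
  have : U.map star = star U := by
    conv_lhs => rw [← h]
    rfl
  rw [this, Matrix.mem_unitaryGroup_iff.1 hU]

lemma localAct_sub_smul (U V W : Matrix (Fin 2) (Fin 2) ℂ) (φ ψ : QubitSpace) (t : ℂ) :
    localAct U V W (φ - t • ψ) = localAct U V W φ - t • localAct U V W ψ := by
  simp [localAct, map_sub, map_smul]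

lemma unitary_rows_independent {U : Matrix (Fin 2) (Fin 2) ℂ}
    (hU : U ∈ Matrix.unitaryGroup (Fin 2) ℂ) {X Y : ℂ} (h : ∀ i, U i 1 * X + U i 0 * Y = 0) :
    X = 0 ∧ Y = 0 := by
  have hv : Matrix.mulVec U ![Y, X] = 0 := by
    ext i
    simp [Matrix.mulVec, dotProduct, Fin.sum_univ_two]
    linear_combination h i
  have h2 := congrArg (Matrix.mulVec (star U)) hv
  rw [Matrix.mulVec_mulVec, Matrix.mem_unitaryGroup_iff'.1 hU, Matrix.one_mulVec,
    Matrix.mulVec_zero] at h2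
  exact ⟨by simpa using congrFun h2 1, by simpa using congrFun h2 0⟩

/-- A vector with vanishing coefficients at `|011⟩, |101⟩, |110⟩, |111⟩` is zero if the same is
true of its image under local unitaries without vanishing entries `U 1 0`. -/
lemma eq_zero_of_localAct {U V W : Matrix (Fin 2) (Fin 2) ℂ}
    (hU : U ∈ Matrix.unitaryGroup (Fin 2) ℂ) (hV : V ∈ Matrix.unitaryGroup (Fin 2) ℂ)
    (hW : W ∈ Matrix.unitaryGroup (Fin 2) ℂ) (hU0 : U 1 0 ≠ 0) (hV0 : V 1 0 ≠ 0) (hW0 : W 1 0 ≠ 0)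
    {η : QubitSpace} (h : ∀ i, η (i, 1, 1) = 0 ∧ η (1, i, 1) = 0 ∧ η (1, 1, i) = 0)
    (h' : ∀ i, localAct U V W η (i, 1, 1) = 0 ∧ localAct U V W η (1, i, 1) = 0 ∧
      localAct U V W η (1, 1, i) = 0) : η = 0 := by
  have hc : ∀ α β γ, contract η α β γ = η (1, 0, 0) * (α 1 * β 0 * γ 0) +
      η (0, 1, 0) * (α 0 * β 1 * γ 0) + η (0, 0, 1) * (α 0 * β 0 * γ 1) +
      η (0, 0, 0) * (α 0 * β 0 * γ 0) := by
    intro α β γ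
    simp [contract, Fin.sum_univ_two, (h 0).1, (h 0).2.1, (h 0).2.2, (h 1).1]
    ring
  simp only [localAct_apply, hc] at h'
  obtain ⟨h1, hY⟩ := unitary_rows_independent hU (X := η (1, 0, 0) * (V 1 0 * W 1 0))
    (Y := η (0, 1, 0) * (V 1 1 * W 1 0) + η (0, 0, 1) * (V 1 0 * W 1 1) +
      η (0, 0, 0) * (V 1 0 * W 1 0)) fun i => by linear_combination (h' i).1
  obtain ⟨h2, -⟩ := unitary_rows_independent hV (X := η (0, 1, 0) * (U 1 0 * W 1 0))
    (Y := η (1, 0, 0) * (U 1 1 * W 1 0) + η (0, 0, 1) * (U 1 0 * W 1 1) +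
      η (0, 0, 0) * (U 1 0 * W 1 0)) fun i => by linear_combination (h' i).2.1
  obtain ⟨h3, -⟩ := unitary_rows_independent hW (X := η (0, 0, 1) * (U 1 0 * V 1 0))
    (Y := η (1, 0, 0) * (U 1 1 * V 1 0) + η (0, 1, 0) * (U 1 0 * V 1 1) +
      η (0, 0, 0) * (U 1 0 * V 1 0)) fun i => by linear_combination (h' i).2.2
  have z1 : η (1, 0, 0) = 0 := by simpa [hV0, hW0] using h1
  have z2 : η (0, 1, 0) = 0 := by simpa [hU0, hW0] using h2
  have z3 : η (0, 0, 1) = 0 := by simpa [hU0, hV0] using h3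
  have z0 : η (0, 0, 0) = 0 := by simpa [z2, z3, hV0, hW0] using hY
  ext ⟨i, j, k⟩
  fin_cases i <;> fin_cases j <;> fin_cases k <;>
    simp [z0, z1, z2, z3, (h 0).1, (h 0).2.1, (h 0).2.2, (h 1).1]

/-- If `Φ` vanishes, a canonical state is LU-equivalent to its complex conjugate. -/
theorem LUEquiv_conj (hp : p ∈ Theta) (hpos : p.Positive) (hΦ : Phi p = 0) :
    LUEquiv (qubitState p) (qubitState p.conj) := by
  obtain ⟨α, β, γ, hm, hα, hβ, hγ⟩ := exists_isMaximizer hp hpos hΦ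
  obtain ⟨U, hU, hUs, hU0, r, hr⟩ := exists_symm_unitary hα
  obtain ⟨V, hV, hVs, hV0, s, hs⟩ := exists_symm_unitary hβ
  obtain ⟨W, hW, hWs, hW0, t, ht⟩ := exists_symm_unitary hγ
  set ψ := qubitState p with hψ
  set ψ' := localAct U V W ψ with hψ'
  have hd := Theta_d_pos hp
  have hd0 : (p.d : ℂ) ≠ 0 := by exact_mod_cast hd.ne'
  have e : LUEquiv ψ ψ' := LUEquiv_iff.2 ⟨U, hU, V, hV, W, hW, rfl⟩
  have hnorm : ‖ψ' (1, 1, 1)‖ = p.d := by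
    have nsmul : ∀ (c : ℂ) (x : Fin 2 → ℂ), nsq (c • x) = ‖c‖ ^ 2 * nsq x := by
      intro c x
      simp [nsq, mul_pow]; ring
    have n1 := nsq_row hU 1
    have n2 := nsq_row hV 1
    have n3 := nsq_row hW 1
    rw [hr, nsmul] at n1
    rw [hs, nsmul] at n2
    rw [ht, nsmul] at n3
    refine (pow_left_inj₀ (norm_nonneg _) hd.le two_ne_zero).1 ?_
    rw [hψ', ← contract_row, hr, hs, ht, contract_smul, norm_mul, mul_pow, hm.2.2.2, norm_mul,
      norm_mul]
    calc (‖r‖ * ‖s‖ * ‖t‖) ^ 2 * (p.d ^ 2 * (nsq α * nsq β * nsq γ))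
        = p.d ^ 2 * ((‖r‖ ^ 2 * nsq α) * (‖s‖ ^ 2 * nsq β) * (‖t‖ ^ 2 * nsq γ)) := by ring
      _ = p.d ^ 2 := by rw [n1, n2, n3]; ring
  have hB : OverlapBound ψ' ‖ψ' (1, 1, 1)‖ := by
    rw [hnorm]
    exact ((mem_Theta_iff p).1 hp).2.2.2.2.2.2.of_LUEquiv e
  obtain ⟨y1, y2, y3⟩ := apply_eq_zero_of_overlapBound hB
  obtain ⟨x, hx⟩ : ∃ x, x = ψ' (1, 1, 1) / p.d := ⟨_, rfl⟩
  have hx1 : ‖x‖ = 1 := by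
    rw [hx, norm_div, hnorm, Complex.norm_real, Real.norm_of_nonneg hd.le, div_self hd.ne']
  have hxd : ψ' (1, 1, 1) = x * p.d := by rw [hx]; field_simp
  have hxx : star x * x = 1 := by
    rw [Complex.star_def, Complex.conj_mul', hx1]; simp
  have p0 : ψ (1, 1, 1) = p.d := by rw [hψ, qubitState_apply]; rfl
  have p1 : ψ (0, 1, 1) = 0 := by rw [hψ, qubitState_apply]; rfl
  have p2 : ψ (1, 0, 1) = 0 := by rw [hψ, qubitState_apply]; rfl
  have p3 : ψ (1, 1, 0) = 0 := by rw [hψ, qubitState_apply]; rfl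
  -- Since U, V, W are symmetric, each times its entrywise conjugate is 1, so they map conj ψ' to
  -- conj ψ. Hence the difference and its image conj ψ - x̄ψ' both vanish at |011⟩, |101⟩, |110⟩,
  -- |111⟩.
  have hη : conjState ψ' - star x • ψ = 0 := by
    refine eq_zero_of_localAct hU hV hW hU0 hV0 hW0 ?_ ?_
    · intro i
      fin_cases i <;> simp [conjState_apply, y1, y2, y3, p0, p1, p2, p3, hxd]
    · rw [localAct_sub_smul, ← hψ', hψ', conjState_localAct, localAct_localAct,
        mul_map_star_of_symm hU hUs, mul_map_star_of_symm hV hVs, mul_map_star_of_symm hW hWs,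
        localAct_one, ← hψ']
      simp only [Complex.star_def] at hxx
      intro i
      fin_cases i <;>
        simp [conjState_apply, y1, y2, y3, p0, p1, p2, p3, hxd, ← mul_assoc, hxx]
  have hfin : ψ' = x • qubitState p.conj := by
    rw [← conjState_qubitState, ← hψ]
    ext m
    have := congrArg (fun φ : QubitSpace => star (φ m)) hη
    simp only [PiLp.sub_apply, PiLp.smul_apply, conjState_apply, smul_eq_mul, star_sub, star_mul',
      star_star, PiLp.zero_apply, star_zero, sub_eq_zero] at this
    rw [this, PiLp.smul_apply, smul_eq_mul, conjState_apply]
  exact e.trans (hfin ▸ (LUEquiv_smul hx1 (qubitState p.conj)).symm)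

end Theta

/-! ### The relative interior of `Θ` -/

section Theta

variable {p q : Point}

lemma Theta_mem_nhdsWithin (hp : p ∈ Theta) (hpos : p.Positive) (hΦ : 0 < Phi p) :
    Theta ∈ 𝓝[Sphere] p := by
  have ca : Continuous Point.a := by unfold Point.a; fun_prop
  have cb : Continuous Point.b := by unfold Point.b; fun_prop
  have cc : Continuous Point.c := by unfold Point.c; fun_prop
  have cd : Continuous Point.d := by unfold Point.d; fun_prop
  have cz : Continuous Point.z := by unfold Point.z; fun_prop
  have cx : Continuous Point.x := Complex.continuous_re.comp cz
  have cy : Continuous Point.y := Complex.continuous_im.comp cz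
  have ce : Continuous Point.curvRe := by unfold Point.curvRe; fun_prop
  have cΦ : Continuous Phi := by unfold Phi; fun_prop
  refine mem_nhdsWithin.2 ⟨{q | 0 < q.a} ∩ {q | 0 < q.b} ∩ {q | 0 < q.c} ∩ {q | 0 < q.x} ∩
    {q | 0 < q.d} ∩ {q | 0 < q.curvRe} ∩ {q | 0 < Phi q}, ?_, ?_, ?_⟩
  · exact (((((((isOpen_lt continuous_const ca).inter (isOpen_lt continuous_const cb)).inter
      (isOpen_lt continuous_const cc)).inter (isOpen_lt continuous_const cx)).inter
      (isOpen_lt continuous_const cd)).inter (isOpen_lt continuous_const ce)).inter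
      (isOpen_lt continuous_const cΦ))
  · exact ⟨⟨⟨⟨⟨⟨hpos.1, hpos.2.1⟩, hpos.2.2.1⟩, hpos.2.2.2⟩, Theta_d_pos hp⟩,
      (Theta_curvRe_pos hp hpos).1⟩, hΦ⟩
  · rintro q ⟨⟨⟨⟨⟨⟨⟨ha, hb⟩, hc⟩, hx⟩, hd⟩, he⟩, hΦ'⟩, hs⟩
    exact (mem_Theta_iff q).2 ⟨hs, ha.le, hb.le, hc.le, hd.le, hx.le,
      overlapBound_of_Phi_pos ⟨ha, hb, hc, hx⟩ hd he hΦ'⟩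

/-- In every direction from an interior point of `Θ` there are points of the cone over `Θ`. -/
lemma exists_smul_mem_Theta (hp : p ∈ Sphere) (h : Theta ∈ 𝓝[Sphere] p) (v : Point) :
    ∃ ε : ℝ, 0 < ε ∧ ∃ t : ℝ, 0 < t ∧ t • (p + ε • v) ∈ Theta := by
  -- Radial projection of the line through p back onto the sphere.
  let F : ℝ → Point := fun ε => (‖qubitState (p + ε • v)‖)⁻¹ • (p + ε • v)
  have hp1 := (mem_sphere_iff p).1 hp
  have hcN : Continuous fun ε : ℝ => ‖qubitState (p + ε • v)‖ := by
    refine Continuous.norm ?_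
    unfold qubitState Point.a Point.b Point.c Point.d Point.z
    fun_prop
  have hN0 : ‖qubitState (p + (0 : ℝ) • v)‖ = 1 := by rw [zero_smul, add_zero, hp1]
  have hF : Filter.Tendsto F (𝓝 0) (𝓝 p) := by
    have h1 : ContinuousAt F 0 := by
      refine ContinuousAt.smul (hcN.continuousAt.inv₀ ?_) (by fun_prop)
      rw [hN0]; exact one_ne_zero
    have h2 : F 0 = p := by
      simp only [F]
      rw [hN0, zero_smul, add_zero, inv_one, one_smul]
    have h3 := h1.tendsto
    rwa [h2] at h3
  have hpos : ∀ᶠ ε in 𝓝 (0 : ℝ), 0 < ‖qubitState (p + ε • v)‖ :=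
    hcN.continuousAt.eventually (lt_mem_nhds (one_pos.trans_eq hN0.symm))
  have hscale : ∀ (t : ℝ) (q : Point), qubitState (t • q) = (t : ℂ) • qubitState q := by
    intro t q
    ext ⟨i, j, k⟩
    rw [PiLp.smul_apply, qubitState_apply, qubitState_apply]
    fin_cases i <;> fin_cases j <;> fin_cases k <;>
      simp [Point.a, Point.b, Point.c, Point.d, Point.z]
  have hFs : ∀ᶠ ε in 𝓝 (0 : ℝ), F ε ∈ Sphere := by
    filter_upwards [hpos] with ε hε
    rw [mem_sphere_iff, hscale, norm_smul, Complex.norm_real, norm_inv, norm_norm,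
      inv_mul_cancel₀ hε.ne']
  have hT : ∀ᶠ ε in 𝓝 (0 : ℝ), F ε ∈ Theta :=
    (tendsto_nhdsWithin_iff.2 ⟨hF, hFs⟩).eventually h
  obtain ⟨ε, ⟨hε1, hε2⟩, hε⟩ := (((hT.and hpos).filter_mono nhdsWithin_le_nhds).and
    (self_mem_nhdsWithin (s := Set.Ioi (0 : ℝ)))).exists
  exact ⟨ε, hε, _, inv_pos.2 hε2, hε1⟩

lemma Phi_smul (t : ℝ) (p : Point) : Phi (t • p) = t ^ 6 * Phi p := by
  have ha : (t • p).a = t * p.a := rfl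
  have hb : (t • p).b = t * p.b := rfl
  have hc : (t • p).c = t * p.c := rfl
  have hd : (t • p).d = t * p.d := rfl
  have hx : (t • p).x = t * p.x := by simp [Point.x, Point.z]
  have hy : (t • p).y = t * p.y := by simp [Point.y, Point.z]
  simp only [Phi, Point.norm_z_sq, ha, hb, hc, hd, hx, hy]
  ring

theorem positive_of_mem_nhdsWithin (hp : p ∈ Theta) (h : Theta ∈ 𝓝[Sphere] p) :
    p.Positive ∧ 0 < Phi p := by
  obtain ⟨hs, ha, hb, hc, hd, hx, hB⟩ := (mem_Theta_iff p).1 hp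
  have dir := exists_smul_mem_Theta hs h
  have neg : ∀ {u ε t : ℝ}, 0 ≤ u → 0 < ε → 0 < t → 0 ≤ t * (u + ε * -1) → 0 < u := by
    intro u ε t hu hε ht h
    have := nonneg_of_mul_nonneg_right h ht
    linarith
  have pa : 0 < p.a := by
    obtain ⟨ε, hε, t, ht, hm⟩ := dir (![-1, 0, 0], 0, 0)
    exact neg ha hε ht ((mem_Theta_iff _).1 hm).2.1
  have pb : 0 < p.b := by
    obtain ⟨ε, hε, t, ht, hm⟩ := dir (![0, -1, 0], 0, 0)
    exact neg hb hε ht ((mem_Theta_iff _).1 hm).2.2.1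
  have pc : 0 < p.c := by
    obtain ⟨ε, hε, t, ht, hm⟩ := dir (![0, 0, -1], 0, 0)
    exact neg hc hε ht ((mem_Theta_iff _).1 hm).2.2.2.1
  have px : 0 < p.x := by
    obtain ⟨ε, hε, t, ht, hm⟩ := dir (0, 0, -1)
    have h1 := ((mem_Theta_iff _).1 hm).2.2.2.2.2.1
    have e : (t • (p + ε • ((0, 0, -1) : Point))).x = t * (p.x + ε * -1) := by
      simp [Point.x, Point.z]
      ring
    rw [e] at h1
    exact neg hx hε ht h1
  have hpos : p.Positive := ⟨pa, pb, pc, px⟩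
  refine ⟨hpos, (Theta_Phi_nonneg hp hpos).lt_of_ne' fun hΦ => ?_⟩
  -- Increasing x lowers Φ by `curvIm` times 2xε + ε², hence below zero; rescaling keeps the sign,
  -- since Φ is homogeneous.
  obtain ⟨ε, hε, t, ht, hm⟩ := dir (0, 0, 1)
  set q : Point := p + ε • ((0, 0, 1) : Point) with hq
  have qa : q.a = p.a := by simp [hq, Point.a]
  have qb : q.b = p.b := by simp [hq, Point.b]
  have qc : q.c = p.c := by simp [hq, Point.c]
  have qd : q.d = p.d := by simp [hq, Point.d]
  have qx : q.x = p.x + ε := by simp [hq, Point.x, Point.z]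
  have qy : q.y = p.y := by simp [hq, Point.y, Point.z]
  have hne : (t • q).a * (t • q).b * (t • q).c * (t • q).x ≠ 0 := by
    have e : (t • q).a * (t • q).b * (t • q).c * (t • q).x =
        (t * q.a) * (t * q.b) * (t * q.c) * (t * q.x) := by
      simp [Point.a, Point.b, Point.c, Point.x, Point.z]
    rw [e, qa, qb, qc, qx]
    positivity
  have h1 := Theta_Phi_nonneg hm (Theta_positive_of_ne hm hne)
  rw [Phi_smul] at h1
  have h2 := nonneg_of_mul_nonneg_right h1 (by positivity)
  have h3 := hpos.curvIm_pos (Theta_d_pos hp) (Theta_curvRe_pos hp hpos).1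
  have e : Phi q = Phi p - p.curvIm * (2 * p.x * ε + ε ^ 2) := by
    simp only [Phi, Point.norm_z_sq, qa, qb, qc, qd, qx, qy, Point.curvIm]
    ring
  rw [e, hΦ] at h2
  have : 0 < p.curvIm * (2 * p.x * ε + ε ^ 2) := by positivity
  linarith

lemma product_pos_iff (hp : p ∈ Theta) :
    0 < p.a * p.b * p.c * p.x * Phi p ↔ p.Positive ∧ 0 < Phi p := by
  constructor
  · intro h
    have h0 : p.a * p.b * p.c * p.x ≠ 0 := fun h0 => by
      rw [h0, zero_mul] at h
      exact h.false
    have hpos := Theta_positive_of_ne hp h0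
    exact ⟨hpos, (Theta_Phi_nonneg hp hpos).lt_of_ne' fun h1 => by
      rw [h1, mul_zero] at h
      exact h.false⟩
  · rintro ⟨⟨ha, hb, hc, hx⟩, hΦ⟩
    positivity

lemma product_nonneg (hp : p ∈ Theta) : 0 ≤ p.a * p.b * p.c * p.x * Phi p := by
  by_cases h0 : p.a * p.b * p.c * p.x = 0
  · rw [h0, zero_mul]
  · have hpos := Theta_positive_of_ne hp h0
    have hΦ := Theta_Phi_nonneg hp hpos
    obtain ⟨ha, hb, hc, hx⟩ := hpos
    positivity

theorem product_pos_iff_mem_interior (hp : p ∈ Theta) :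
    0 < p.a * p.b * p.c * p.x * Phi p ↔ p ∈ ThetaInterior := by
  rw [product_pos_iff hp]
  exact ⟨fun h => ⟨hp, Theta_mem_nhdsWithin hp h.1 h.2⟩,
    fun h => positive_of_mem_nhdsWithin hp h.2⟩

theorem product_eq_zero_iff_mem_boundary (hp : p ∈ Theta) :
    p.a * p.b * p.c * p.x * Phi p = 0 ↔ p ∈ ThetaBoundary := by
  have h1 : p ∈ ThetaBoundary ↔ ¬ p ∈ ThetaInterior := ⟨fun h => h.2, fun h => ⟨hp, h⟩⟩
  rw [h1, ← product_pos_iff_mem_interior hp, not_lt]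
  exact ⟨fun h => h.le, fun h => le_antisymm h (product_nonneg hp)⟩

/-! ### The normalization on the boundary -/

lemma LUEquiv_qubitState_of_phase {g u v w : ℂ} (hg : ‖g‖ = 1) (hu : ‖u‖ = 1) (hv : ‖v‖ = 1)
    (hw : ‖w‖ = 1) (h : g ^ 2 = u * v * w) (ha : u * p.a = p.a) (hb : v * p.b = p.b)
    (hc : w * p.c = p.c) (qa : q.a = p.a) (qb : q.b = p.b) (qc : q.c = p.c) (qd : q.d = p.d)
    (qz : g * p.z = q.z) : LUEquiv (qubitState p) (qubitState q) := by
  refine LUEquiv_qubitState_of_phases (t := 1) ?_ ?_ ?_ hg hu hv hw (by rw [one_mul, h])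
    ?_ ?_ ?_ ?_ ?_ <;> rw [qubitState_apply]
  · rfl
  · rfl
  · rfl
  · rw [qa]; exact ha
  · rw [qb]; exact hb
  · rw [qc]; exact hc
  · rw [qd]; exact one_mul _
  · exact qz

/-- The phase attached to a vanishing coordinate is unconstrained and absorbs g², so z can be
rotated to |z|. -/
lemma exists_real_of_abc_eq_zero (hp : p ∈ Theta) (h0 : p.a * p.b * p.c = 0) :
    ∃ q ∈ Theta, LUEquiv (qubitState p) (qubitState q) ∧ q.y = 0 := by
  obtain ⟨g, hg, hgz⟩ := exists_phase_mul_eq_norm p.z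
  let q : Point := (p.1, p.2.1, (‖p.z‖ : ℂ))
  have hg2 : ‖g ^ 2‖ = 1 := by rw [norm_pow, hg, one_pow]
  have e : LUEquiv (qubitState p) (qubitState q) := by
    rcases mul_eq_zero.1 h0 with h | h
    · rcases mul_eq_zero.1 h with h | h
      · exact LUEquiv_qubitState_of_phase hg hg2 norm_one norm_one (by ring) (by simp [h])
          (one_mul _) (one_mul _) rfl rfl rfl rfl hgz
      · exact LUEquiv_qubitState_of_phase hg norm_one hg2 norm_one (by ring) (one_mul _)
          (by simp [h]) (one_mul _) rfl rfl rfl rfl hgz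
    · exact LUEquiv_qubitState_of_phase hg norm_one norm_one hg2 (by ring) (one_mul _) (one_mul _)
        (by simp [h]) rfl rfl rfl rfl hgz
  obtain ⟨-, ha, hb, hc, -⟩ := (mem_Theta_iff p).1 hp
  exact ⟨q, mem_Theta_of_LUEquiv hp e ha hb hc rfl (norm_nonneg p.z), e, Complex.ofReal_im _⟩

lemma exists_nonneg_of_product_eq_zero (hp : p ∈ Theta)
    (h0 : p.a * p.b * p.c * p.x * Phi p = 0) :
    ∃ q ∈ Theta, LUEquiv (qubitState p) (qubitState q) ∧ 0 ≤ q.y ∧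
      (q.a * q.b * q.c = 0 → q.y = 0) := by
  by_cases habc : p.a * p.b * p.c = 0
  · obtain ⟨q, hq, e, hy⟩ := exists_real_of_abc_eq_zero hp habc
    exact ⟨q, hq, e, hy.ge, fun _ => hy⟩
  rcases le_or_gt 0 p.y with hy | hy
  · refine ⟨p, hp, ?_, hy, fun h => absurd h habc⟩
    simpa using LUEquiv_smul norm_one (qubitState p)
  obtain ⟨-, ha, hb, hc, -, hx, -⟩ := (mem_Theta_iff p).1 hp
  by_cases hx0 : p.x = 0
  · let q : Point := (p.1, p.2.1, -p.2.2)
    have e : LUEquiv (qubitState p) (qubitState q) :=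
      LUEquiv_qubitState_of_phase (g := -1) (u := 1) (v := 1) (w := 1) (by simp) norm_one norm_one
        norm_one (by ring) (one_mul _) (one_mul _) (one_mul _) rfl rfl rfl rfl (neg_one_mul _)
    have qx : q.x = 0 := by
      have : q.x = -p.x := rfl
      rw [this, hx0, neg_zero]
    have qy : q.y = -p.y := rfl
    exact ⟨q, mem_Theta_of_LUEquiv hp e ha hb hc rfl qx.ge, e, by rw [qy]; linarith,
      fun h => absurd h habc⟩
  · have hne : p.a * p.b * p.c * p.x ≠ 0 := mul_ne_zero habc hx0
    have e := LUEquiv_conj hp (Theta_positive_of_ne hp hne)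
      ((mul_eq_zero.1 h0).resolve_left hne)
    have qy : p.conj.y = -p.y := rfl
    exact ⟨p.conj, mem_Theta_of_LUEquiv hp e ha hb hc rfl hx, e, by rw [qy]; linarith,
      fun h => absurd h habc⟩

lemma eq_of_LUEquiv_of_normalized (hp : p ∈ Theta) (hq : q ∈ Theta)
    (e : LUEquiv (qubitState p) (qubitState q))
    (hpy : 0 ≤ p.y ∧ (p.a * p.b * p.c = 0 → p.y = 0))
    (hqy : 0 ≤ q.y ∧ (q.a * q.b * q.c = 0 → q.y = 0)) : q = p := by
  obtain ⟨ha, hb, hc, hd, hz⟩ := Theta_abcd_eq hp hq e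
  refine Point.ext_coords ha hb hc hd ?_
  by_cases h0 : p.a * p.b * p.c = 0
  · have py := hpy.2 h0
    have qy := hqy.2 (by rw [ha, hb, hc, h0])
    rw [py, qy] at hz
    have hpx := ((mem_Theta_iff p).1 hp).2.2.2.2.2.1
    have hqx := ((mem_Theta_iff q).1 hq).2.2.2.2.2.1
    exact Complex.ext ((pow_left_inj₀ hqx hpx two_ne_zero).1 (by linarith)) (qy.trans py.symm)
  · obtain ⟨hx, hy⟩ := Theta_xy_eq hp hq e h0
    exact Complex.ext hx ((pow_left_inj₀ hqy.1 hpy.1 two_ne_zero).1 hy)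

end Theta

end ThreeQubit

theorem mainTheorem6 :
    -- existence of a representative in `Θ`
    (∀ φ : QubitSpace, ‖φ‖ = 1 → ∃ p ∈ Theta, LUEquiv φ (qubitState p)) ∧
    -- uniqueness when `abcxΦ(p) > 0`
    (∀ φ : QubitSpace, ‖φ‖ = 1 → ∀ p ∈ Theta, LUEquiv φ (qubitState p) →
      0 < p.a * p.b * p.c * p.x * Phi p →
        ∀ q ∈ Theta, LUEquiv φ (qubitState q) → qubitState q = qubitState p ∧ q = p) ∧
    -- the two cases are the relative interior and the relative boundary of `Θ`
    (∀ p ∈ Theta,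
      (0 < p.a * p.b * p.c * p.x * Phi p ↔ p ∈ ThetaInterior) ∧
      (p.a * p.b * p.c * p.x * Phi p = 0 ↔ p ∈ ThetaBoundary)) ∧
    -- existence and uniqueness with the boundary normalization
    (∀ φ : QubitSpace, ‖φ‖ = 1 →
      ∃! p : Point, p ∈ Theta ∧ LUEquiv φ (qubitState p) ∧
        (p.a * p.b * p.c * p.x * Phi p = 0 →
          0 ≤ p.y ∧ (p.a * p.b * p.c = 0 → p.y = 0))) := by
  refine ⟨fun φ hφ => exists_mem_Theta hφ, ?_, fun p hp =>
    ⟨product_pos_iff_mem_interior hp, product_eq_zero_iff_mem_boundary hp⟩, ?_⟩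
  · intro φ _ p hp e h q hq e'
    obtain ⟨hpos, hΦ⟩ := (product_pos_iff hp).1 h
    have := eq_of_LUEquiv_of_Phi_pos hp hpos hΦ hq (e.symm.trans e')
    exact ⟨by rw [this], this⟩
  · intro φ hφ
    have exist : ∃ p, p ∈ Theta ∧ LUEquiv φ (qubitState p) ∧
        (p.a * p.b * p.c * p.x * Phi p = 0 →
          0 ≤ p.y ∧ (p.a * p.b * p.c = 0 → p.y = 0)) := by
      obtain ⟨p, hp, e⟩ := exists_mem_Theta hφ
      by_cases h : p.a * p.b * p.c * p.x * Phi p = 0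
      · obtain ⟨q, hq, e', hy⟩ := exists_nonneg_of_product_eq_zero hp h
        exact ⟨q, hq, e.trans e', fun _ => hy⟩
      · exact ⟨p, hp, e, fun h' => absurd h' h⟩
    obtain ⟨p, hp, e, hy⟩ := exist
    refine ⟨p, ⟨hp, e, hy⟩, ?_⟩
    rintro q ⟨hq, e', hy'⟩
    have epq := e.symm.trans e'
    by_cases h : p.a * p.b * p.c * p.x * Phi p = 0
    -- If only q has a nonzero product, the uniqueness theorem is applied with q as base point.
    · by_cases h' : q.a * q.b * q.c * q.x * Phi q = 0
      · exact eq_of_LUEquiv_of_normalized hp hq epq (hy h) (hy' h')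
      · obtain ⟨hpos, hΦ⟩ := (product_pos_iff hq).1 ((product_nonneg hq).lt_of_ne' h')
        exact (eq_of_LUEquiv_of_Phi_pos hq hpos hΦ hp epq.symm).symm
    · obtain ⟨hpos, hΦ⟩ := (product_pos_iff hp).1 ((product_nonneg hp).lt_of_ne' h)
      exact eq_of_LUEquiv_of_Phi_pos hp hpos hΦ hq epq
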